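/- **Proposition 4.1 (Likelihood).** Let $T>0$. For $i,j\in\{A,B\}$ let $\mu^i:\mathbb R_+\to\mathbb R_+$ be measurable, $\alpha_{ij}\ge 0$, $\beta_{ij}>0$, $\eta_i\ge 0$, $\beta_i>0$; put $f_i(v)=\beta_i e^{-\beta_i v}$ for $v\ge 0$ (and $0$ for $v<0$) and $g_i(v)=v^{\eta_i}/\mathbb E[V_i^{\eta_i}]$, where $V_i$ is exponentially distributed with parameter $\beta_i$. Let $N^{A\times B}=(N^A,N^B)$ be a bivariate marked point process on a probability space $(\Omega,\mathbb F,\mathbb P)$: $N^i$ is the counting measure of points $(\tau^i_k,v^i_k)\in(0,\infty)\times\mathbb R_+$, and $N^A$, $N^B$ have no simultaneous events. Let $\mathcal F_s$ be generated by the variables $N^i((0,r]\times K)$ with $i\in\{A,B\}$, $r\le s$, $K$ Borel. Assume that $N^{A\times B}$ is a marked Hawkes process on $[0,T]$, i.e. that $\mathbb E[N^i((0,T]\times\mathbb R_+)]<\infty$ and that, for all $i$, all $0\le s\le t\le T$ and all Borel sets $K$, almost surely $$\mathbb E\big[N^i((s,t]\times K)\,\big|\,\mathcal F_s\big]=\mathbb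 E\Big[\int_s^t\!\int_K\lambda^i_g(u)f_i(v)\,dv\,du\,\Big|\,\mathcal F_s\Big],\qquad \lambda^i_g(u)=\mu^i(u)+\sum_{j\in\{A,B\}}\sum_{\tau^j_{k'}<u}\alpha_{ij}e^{-\beta_{ij}(u-\tau^j_{k'})}g_j(v^j_{k'}).$$ Let $L$ be the likelihood of $\{N^{A\times B}(t)\}_{t\le T}$, i.e. the density of the law of the chronological list of its events (time, coordinate, mark) in $[0,T]$ with respect to $\sum_{n\ge0}(\mathrm{Leb}\otimes\mathrm{count}\otimes\mathrm{Leb})^{\otimes n}$. Let $L_0$ be the likelihood of the (univariate) unit rate Poisson process on $[0,T]$, i.e. the density of the law of the chronological list of its event times in $[0,T]$ with respect to $\sum_{n\ge0}\mathrm{Leb}^{\otimes n}$. Then both densities exist, and the log-likelihood $\ell=\ln(L/L_0)$ relative to the unit rate Poisson process, where $L$ is evaluated at the observed realization and $L_0$ at the chronological list of all its event times, is almost surely equal to $$\begin{aligned}\ell={}&T-\sum_{i\in\{A,B\}}\Big(\int_0^T\mu^i(u)\,du+\sum_{j\in\{A,B\}}\sum_{\tau^j_{k'}<T}\frac{\alpha_{ij}}{\beta_{ij}}\frac{\beta_j^{\eta_j}}{\Gamma(1+\eta_j)}(v^j_{k'})^{\eta_j}\big(1-e^{-\beta_{ij}(T-\tau^j_{k'})}\big)\Big)\\&+\sum_{i\in\{A,B\}}\sum_{\tau^i_k\le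 T}\ln\Big(\mu^i(\tau^i_k)+\sum_{j\in\{A,B\}}\sum_{\tau^j_{k'}<\tau^i_k}\alpha_{ij}\frac{\beta_j^{\eta_j}}{\Gamma(1+\eta_j)}(v^j_{k'})^{\eta_j}e^{-\beta_{ij}(\tau^i_k-\tau^j_{k'})}\Big)+\sum_{i\in\{A,B\}}\sum_{\tau^i_k\le T}\ln f_i(v^i_k).\end{aligned}$$ -/

import Mathlib

open MeasureTheory ProbabilityTheory
open scoped ENNReal

noncomputable section

/-! ### Finite realizations and Janossy densities -/

/-- A finite realization: a number `n` of points together with the list of these points. -/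
abbrev Realization (X : Type*) : Type _ := Σ n : ℕ, Fin n → X

/-- The reference measure `∑ₙ κⁿ` on finite realizations. The density with respect to it of the law
of the list of points of a point process, listed in the order of their times, is the Janossy
density of the process, i.e. its likelihood. -/
def realizationMeasure {X : Type*} [MeasurableSpace X] (κ : Measure X) :
    Measure (Realization X) :=
  Measure.sum fun n : ℕ => (Measure.pi fun _ : Fin n => κ).map (Sigma.mk n)

/-- The realization on the time window `[0, T]` of a sequence of points `x 0, x 1, …` that occur at
the increasing times `t 0, t 1, …` (`∞` if there is no such point): the points with `t k ≤ T`. -/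
def observe {X : Type*} (T : ℝ) (t : ℕ → ℝ≥0∞) (x : ℕ → X) : Realization X :=
  ⟨{k : ℕ | t k ≤ ENNReal.ofReal T}.ncard, fun k => x k⟩

/-! ### The unit rate Poisson process -/

instance isProbabilityMeasure_expMeasure_one : IsProbabilityMeasure (expMeasure 1) :=
  isProbabilityMeasure_expMeasure one_pos

/-- The `k`-th arrival time (from `k = 0`) of the renewal process with inter-arrival times `w`. -/
def arrivalTime (w : ℕ → ℝ) (k : ℕ) : ℝ := ∑ l ∈ Finset.range (k + 1), w l

/-- The law of the event times in `[0, T]` of the unit rate Poisson process, whose inter-arrival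
times are i.i.d. exponential variables of parameter one. -/
def unitPoissonLaw (T : ℝ) : Measure (Realization ℝ) :=
  (Measure.infinitePi fun _ : ℕ => expMeasure 1).map fun w =>
    observe T (fun k => ENNReal.ofReal (arrivalTime w k)) (arrivalTime w)

/-- The likelihood of the unit rate Poisson process on `[0, T]`. -/
def unitPoissonLikelihood (T : ℝ) : Realization ℝ → ℝ≥0∞ :=
  (unitPoissonLaw T).rnDeriv (realizationMeasure volume)

/-! ### Bivariate marked point processes -/

/-- A bivariate marked point process without simultaneous events. The events of the two coordinates
are listed together: the `k`-th event happens at the time `time k` (`∞` if there is no such event),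
belongs to the coordinate `side k` (`0` is the ask side `A`, `1` is the bid side `B`) and carries
the mark (volume) `mark k`. -/
structure MarkedPointProcess (Ω : Type*) [MeasurableSpace Ω] where
  time : ℕ → Ω → ℝ≥0∞
  side : ℕ → Ω → Fin 2
  mark : ℕ → Ω → ℝ
  measurable_time : ∀ k, Measurable (time k)
  measurable_side : ∀ k, Measurable (side k)
  measurable_mark : ∀ k, Measurable (mark k)
  time_pos : ∀ k ω, 0 < time k ω
  time_le : ∀ k ω, time k ω ≤ time (k + 1) ω
  time_lt : ∀ k ω, time k ω < ∞ → time k ω < time (k + 1) ω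
  mark_nonneg : ∀ k ω, 0 ≤ mark k ω

namespace MarkedPointProcess

variable {Ω : Type*} [MeasurableSpace Ω] (N : MarkedPointProcess Ω)

open Classical in
/-- `N^i((s, t] × K)`: the number of events of coordinate `i` in `(s, t]` with mark in `K`. -/
def count (i : Fin 2) (s t : ℝ) (K : Set ℝ) (ω : Ω) : ℝ≥0∞ :=
  ∑' k, if ENNReal.ofReal s < N.time k ω ∧ N.time k ω ≤ ENNReal.ofReal t ∧
    N.side k ω = i ∧ N.mark k ω ∈ K then 1 else 0

/-- The internal history of the process up to time `s`: the `σ`-algebra generated by the counts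
`N^i((0, r] × K)` with `r ≤ s`. -/
abbrev history (s : ℝ) : MeasurableSpace Ω :=
  ⨆ (i : Fin 2) (r : ℝ) (_ : r ≤ s) (K : Set ℝ) (_ : MeasurableSet K),
    MeasurableSpace.comap (N.count i 0 r K) inferInstance

/-- The indices of the events of coordinate `i` in `[0, T]`. -/
def events (T : ℝ) (i : Fin 2) (ω : Ω) : Finset ℕ :=
  (Finset.range {k : ℕ | N.time k ω ≤ ENNReal.ofReal T}.ncard).filter fun k => N.side k ω = i

/-- The realization of the process on `[0, T]`: its events (time, side, mark) with time at most `T`,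
in chronological order. -/
def path (T : ℝ) (ω : Ω) : Realization (ℝ × Fin 2 × ℝ) :=
  observe T (fun k => N.time k ω) fun k => ((N.time k ω).toReal, N.side k ω, N.mark k ω)

/-- The event times of the process (both coordinates) in `[0, T]`, in chronological order. -/
def groundPath (T : ℝ) (ω : Ω) : Realization ℝ :=
  observe T (fun k => N.time k ω) fun k => (N.time k ω).toReal

/-- The reference measure for realizations of a bivariate marked point process: Lebesgue measure in
the times, counting measure in the sides, Lebesgue measure in the marks. -/
def pathMeasure : Measure (Realization (ℝ × Fin 2 × ℝ)) :=
  realizationMeasure (volume.prod (Measure.count.prod volume))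

/-- The likelihood of the process on `[0, T]`: the density of the law of its realization. -/
def likelihood (P : Measure Ω) (T : ℝ) : Realization (ℝ × Fin 2 × ℝ) → ℝ≥0∞ :=
  (P.map (N.path T)).rnDeriv pathMeasure

/-- The log-likelihood of the observed realization on `[0, T]` relative to the unit rate Poisson
process: the logarithm (in `[-∞, ∞]`) of the quotient of the two likelihoods. -/
def logLikelihood (P : Measure Ω) (T : ℝ) (ω : Ω) : EReal :=
  ENNReal.log (N.likelihood P T (N.path T ω) / unitPoissonLikelihood T (N.groundPath T ω))

end MarkedPointProcess

/-! ### The marked Hawkes model -/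

/-- The parameters of the model: baselines `μ i`, kernels `α i j * exp (-β i j * t)`, exponents
`η i` of the power-law impact functions, and parameters `rate i` of the exponential laws of the
marks. -/
structure HawkesParams where
  μ : Fin 2 → ℝ → ℝ
  α : Fin 2 → Fin 2 → ℝ
  β : Fin 2 → Fin 2 → ℝ
  η : Fin 2 → ℝ
  rate : Fin 2 → ℝ
  measurable_μ : ∀ i, Measurable (μ i)
  μ_nonneg : ∀ i t, 0 ≤ t → 0 ≤ μ i t
  α_nonneg : ∀ i j, 0 ≤ α i j
  β_pos : ∀ i j, 0 < β i j
  η_nonneg : ∀ i, 0 ≤ η i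
  rate_pos : ∀ i, 0 < rate i

namespace HawkesParams

variable {Ω : Type*} [MeasurableSpace Ω] (p : HawkesParams) (N : MarkedPointProcess Ω)

/-- The normalized power-law impact function `g_j(v) = v ^ η_j / 𝔼[V ^ η_j]`, where `V` is
exponentially distributed with parameter `rate j`. -/
def impact (j : Fin 2) (v : ℝ) : ℝ :=
  v ^ p.η j / ∫ x, x ^ p.η j ∂(expMeasure (p.rate j))

open Classical in
/-- The ground intensity
`λ_g^i(u) = μ^i(u) + ∑_j ∫_{[0, u) × ℝ₊} α_ij e^{-β_ij (u - s)} g_j(v) N^j(ds × dv)`. -/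
def groundIntensity (i : Fin 2) (u : ℝ) (ω : Ω) : ℝ≥0∞ :=
  ENNReal.ofReal (p.μ i u) + ∑' k, if N.time k ω < ENNReal.ofReal u then
    ENNReal.ofReal (p.α i (N.side k ω) * Real.exp (-p.β i (N.side k ω) *
      (u - (N.time k ω).toReal)) * p.impact (N.side k ω) (N.mark k ω)) else 0

/-- The conditional intensity `λ^i(u, v) = λ_g^i(u) f_i(v)`, where `f_i` is the exponential density
of parameter `rate i`. -/
def intensity (i : Fin 2) (u v : ℝ) (ω : Ω) : ℝ≥0∞ :=
  p.groundIntensity N i u ω * exponentialPDF (p.rate i) v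

/-- The increment `∫_{(s, t] × K} λ^i(u, v) du dv` of the compensator. -/
def compensator (i : Fin 2) (s t : ℝ) (K : Set ℝ) (ω : Ω) : ℝ≥0∞ :=
  ∫⁻ u in Set.Ioc s t, ∫⁻ v in K, p.intensity N i u v ω

/-- `N` is, under `P` and on `[0, T]`, a bivariate marked Hawkes process with parameters `p`: the
expected number of events is finite, and `λ^A`, `λ^B` are the conditional intensities of `N` with
respect to its internal history. -/
structure IsMarkedHawkes (P : Measure Ω) (T : ℝ) : Prop where
  lintegral_count_lt_top : ∀ i, ∫⁻ ω, N.count i 0 T Set.univ ω ∂P < ∞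
  condLExp_count : ∀ (i : Fin 2) (s t : ℝ), 0 ≤ s → s ≤ t → t ≤ T →
    ∀ K : Set ℝ, MeasurableSet K →
      P⁻[N.count i s t K | N.history s] =ᵐ[P] P⁻[p.compensator N i s t K | N.history s]

end HawkesParams

end

/-!
The likelihood of the process is computed by generating its events one after the other.

Since the intensity depends on the past events only, between the `n`-th event and the next one it is
a deterministic function of time, the `HawkesParams.hazard` of the first `n` events. The defining
identity of the compensator extends from rectangles `A × (s, t]` to all predictable integrands
(`lintegral_predictable`). Let `Λ` be the integrated hazard of the first `n` events. For the
integrand `exp (Λ(u) - Λ(t))`, restricted to the times `u ≤ t` at which exactly these events have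
happened, the extended identity says, because `(exp Λ)' = Λ' exp Λ`, that given the first `n` events
there is no further event by time `t` with probability `exp (-Λ(t))` (`measure_survival`). Inserting
this into the identity for a general integrand shows that the next event has the density
`hazard * exp (-Λ) * mark density` (`measure_next_point`). The argument needs that the internal
history at a time contains all information on the events up to this time
(`measurableSet_point_history`).

The product of these densities is the density of the law of the list of events, i.e. the Janossy
density (`map_observe_eq_withDensity`, `map_path_eq_withDensity`). Along a path, the integrated
hazards between consecutive events add up to the integral of the ground intensity over `(0, T]`
(`sum_cumHazard`), which is explicit because the kernels are exponential
(`lintegral_groundIntensity`). The moments of the exponential law are values of the Gamma function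
(`integral_rpow_expMeasure`), which makes the impact functions explicit.

The same principle, with independent exponential waiting times, gives the likelihood `exp (-T)` of
the unit rate Poisson process at almost every increasing list of times in `(0, T]`
(`ae_unitPoissonLikelihood`). The law of the path has a density, so the event times of the process
avoid the exceptional null set, and the logarithm of the quotient of the two densities is the
asserted formula. All intensities at the event times are positive almost surely, because a density is
almost surely positive at the realization.
-/

noncomputable section

/-! ### Finite realizations: measurability and σ-finiteness -/

section Realizations

/-- The realization with the `n` points `x 0, …, x (n - 1)`. -/
abbrev realizationOf {X : Type*} (n : ℕ) (x : Fin n → X) : Realization X := ⟨n, x⟩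

lemma realizationOf_injective {X : Type*} (n : ℕ) :
    Function.Injective (realizationOf n : (Fin n → X) → Realization X) :=
  sigma_mk_injective (β := fun n => Fin n → X)

lemma realizationOf_preimage_image_of_ne {X : Type*} {m n : ℕ} (h : m ≠ n)
    (B : Set (Fin n → X)) : realizationOf m ⁻¹' (realizationOf n '' B) = ∅ :=
  Set.preimage_image_sigmaMk_of_ne (α := fun n => Fin n → X) h B

lemma observe_preimage {Ω X : Type*} (T : ℝ) (t : ℕ → Ω → ℝ≥0∞) (x : ℕ → Ω → X) (A : Set (Realization X)) :
    (fun ω => observe T (fun k => t k ω) fun k => x k ω) ⁻¹' A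
      = ⋃ n, {ω | {k : ℕ | t k ω ≤ ENNReal.ofReal T}.ncard = n} ∩
          {ω | (fun k : Fin n => x k ω) ∈ realizationOf n ⁻¹' A} := by
  ext ω
  simp [observe]

/-- The events with time at most `T` are the first `n` ones exactly if the first `n` times are at
most `T` and the next one is not. -/
lemma ncard_le_eq_iff {t : ℕ → ℝ≥0∞} (ht : Monotone t) {c : ℝ≥0∞} (hc : {k | t k ≤ c}.Finite)
    (n : ℕ) : {k | t k ≤ c}.ncard = n ↔ (∀ k < n, t k ≤ c) ∧ c < t n := by
  have key : ∀ m, (∀ k < m, t k ≤ c) ∧ c < t m → {k | t k ≤ c} = Set.Iio m := by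
    rintro m ⟨h1, h2⟩
    ext k
    refine ⟨fun hk => ?_, fun hk => h1 k hk⟩
    by_contra h
    exact absurd (h2.trans_le (ht (not_lt.1 h))) (not_lt.2 hk)
  have hex : ∃ m, (∀ k < m, t k ≤ c) ∧ c < t m := by
    have : ∃ m, c < t m := by
      by_contra! h
      exact Set.infinite_univ (hc.subset fun k _ => h k)
    classical
    exact ⟨Nat.find this, fun k hk => not_lt.1 (Nat.find_min this hk), Nat.find_spec this⟩
  obtain ⟨m, hm⟩ := hex
  have hcard : ∀ m, (Set.Iio m).ncard = m := fun m => by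
    rw [← Finset.coe_Iio, Set.ncard_coe_finset, Nat.card_Iio]
  constructor
  · intro h
    rw [key m hm, hcard] at h
    exact h ▸ hm
  · intro h
    rw [key n h, hcard]

variable {Ω X : Type*} [MeasurableSpace Ω] [MeasurableSpace X]

lemma measurableSet_realization_iff {A : Set (Realization X)} :
    MeasurableSet A ↔ ∀ n, MeasurableSet (realizationOf n ⁻¹' A) := by
  rw [Sigma.instMeasurableSpace, MeasurableSpace.measurableSet_iInf]
  rfl

lemma measurable_realization_mk (n : ℕ) :
    Measurable (realizationOf n : (Fin n → X) → Realization X) := fun _ hA =>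
  measurableSet_realization_iff.1 hA n

lemma measurable_realization_iff {Y : Type*} [MeasurableSpace Y] {f : Realization X → Y} :
    Measurable f ↔ ∀ n, Measurable fun x : Fin n → X => f ⟨n, x⟩ :=
  ⟨fun h n => h.comp (measurable_realization_mk n), fun h _ hA =>
    measurableSet_realization_iff.2 fun n => h n hA⟩

lemma measurableSet_image_realization_mk {n : ℕ} {B : Set (Fin n → X)} (hB : MeasurableSet B) :
    MeasurableSet (realizationOf n '' B : Set (Realization X)) := by
  rw [measurableSet_realization_iff]
  intro m
  rcases eq_or_ne n m with rfl | h
  · rwa [Set.preimage_image_eq _ (realizationOf_injective _)]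
  · rw [realizationOf_preimage_image_of_ne h.symm]
    exact MeasurableSet.empty

lemma realizationMeasure_apply (κ : Measure X) {A : Set (Realization X)} (hA : MeasurableSet A) :
    realizationMeasure κ A = ∑' n, Measure.pi (fun _ : Fin n => κ) (realizationOf n ⁻¹' A) := by
  rw [realizationMeasure, Measure.sum_apply _ hA]
  exact tsum_congr fun n => Measure.map_apply (measurable_realization_mk n) hA

instance sigmaFinite_realizationMeasure (κ : Measure X) [SigmaFinite κ] :
    SigmaFinite (realizationMeasure κ) := by
  let S : ℕ × ℕ → Set (Realization X) := fun q =>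
    realizationOf q.1 '' (spanningSets (Measure.pi fun _ : Fin q.1 => κ) q.2)
  refine Measure.sigmaFinite_of_countable (Set.countable_range S) ?_ ?_
  · rintro _ ⟨⟨n, m⟩, rfl⟩
    have hm := measurableSet_spanningSets (Measure.pi fun _ : Fin n => κ) m
    rw [realizationMeasure_apply κ (measurableSet_image_realization_mk hm),
      tsum_eq_single n fun k hk => by simp [realizationOf_preimage_image_of_ne hk]]
    simp only [Set.preimage_image_eq _ (realizationOf_injective _)]
    exact measure_spanningSets_lt_top _ _
  · refine Set.eq_univ_of_forall fun r => ?_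
    obtain ⟨n, x⟩ := r
    have hx := Set.mem_univ x
    rw [← iUnion_spanningSets (Measure.pi fun _ : Fin n => κ)] at hx
    obtain ⟨m, hm⟩ := Set.mem_iUnion.1 hx
    exact ⟨_, ⟨(n, m), rfl⟩, x, hm, rfl⟩

lemma measurable_ncard_le {t : ℕ → Ω → ℝ≥0∞} (ht : ∀ k, Measurable (t k)) (c : ℝ≥0∞) :
    Measurable fun ω => {k : ℕ | t k ω ≤ c}.ncard := by
  classical
  have h : ∀ ω, (∑' k, if t k ω ≤ c then (1 : ℝ≥0∞) else 0).toReal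
      = (({k : ℕ | t k ω ≤ c}.ncard : ℕ) : ℝ) := by
    intro ω
    have := tsum_subtype {k : ℕ | t k ω ≤ c} (fun _ => (1 : ℝ≥0∞))
    rw [ENNReal.tsum_set_one] at this
    simp only [Set.indicator_apply, Set.mem_ofPred_eq] at this
    rw [← this, Set.ncard_def]
    generalize {k : ℕ | t k ω ≤ c}.encard = e
    cases e <;> simp
  have hm : Measurable fun ω => (({k : ℕ | t k ω ≤ c}.ncard : ℕ) : ℝ) := by
    simp_rw [← h]
    exact (Measurable.tsum fun k => Measurable.ite (measurableSet_le (ht k) measurable_const)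
      measurable_const measurable_const).ennreal_toReal
  have : (fun ω => {k : ℕ | t k ω ≤ c}.ncard)
      = fun ω => ⌊(({k : ℕ | t k ω ≤ c}.ncard : ℕ) : ℝ)⌋₊ := by simp
  rw [this]
  exact hm.nat_floor

lemma measurable_observe (T : ℝ) {t : ℕ → Ω → ℝ≥0∞} (ht : ∀ k, Measurable (t k))
    {x : ℕ → Ω → X} (hx : ∀ k, Measurable (x k)) :
    Measurable fun ω => observe T (fun k => t k ω) fun k => x k ω := by
  intro A hA
  rw [observe_preimage]
  exact MeasurableSet.iUnion fun n =>
    (measurable_ncard_le ht _ (measurableSet_singleton n)).inter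
      ((measurable_pi_lambda _ fun k => hx _) (measurableSet_realization_iff.1 hA n))

end Realizations

/-! ### Densities of sequentially generated points -/

section Chain

/-- The product `∏ₖ a k (x₀, …, xₖ₋₁) xₖ` of the densities of the points of a realization, each
given the points before it. -/
def chainDensity {X : Type*} (a : (n : ℕ) → (Fin n → X) → X → ℝ≥0∞) (n : ℕ) (x : Fin n → X) : ℝ≥0∞ :=
  ∏ k : Fin n, a k (fun l => x (Fin.castLE k.2.le l)) (x k)

lemma chainDensity_succ {X : Type*} (a : (n : ℕ) → (Fin n → X) → X → ℝ≥0∞) (n : ℕ) (x : Fin (n + 1) → X) :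
    chainDensity a (n + 1) x = chainDensity a n (Fin.init x) * a n (Fin.init x) (x (Fin.last n)) :=
  by rw [chainDensity, Fin.prod_univ_castSucc]; rfl

/-- The density of a realization whose points are generated one after the other: `a k` is the
density of the `k`-th point and `s n` the probability that there is no further point, both given the
points before. -/
def janossy {X : Type*} (a : (n : ℕ) → (Fin n → X) → X → ℝ≥0∞) (s : (n : ℕ) → (Fin n → X) → ℝ≥0∞)
    (r : Realization X) : ℝ≥0∞ :=
  chainDensity a r.1 r.2 * s r.1 r.2

variable {Ω X : Type*} [MeasurableSpace Ω] [MeasurableSpace X]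

lemma measurable_chainDensity {a : (n : ℕ) → (Fin n → X) → X → ℝ≥0∞}
    (ha : ∀ n, Measurable (Function.uncurry (a n))) (n : ℕ) : Measurable (chainDensity a n) := by
  refine Finset.measurable_prod _ fun k _ => ?_
  have : Measurable fun x : Fin n → X => ((fun l : Fin k => x (Fin.castLE k.2.le l)), x k) := by
    fun_prop
  exact (ha k).comp this

lemma measurable_janossy {a : (n : ℕ) → (Fin n → X) → X → ℝ≥0∞}
    (ha : ∀ n, Measurable (Function.uncurry (a n))) {s : (n : ℕ) → (Fin n → X) → ℝ≥0∞}
    (hs : ∀ n, Measurable (s n)) : Measurable (janossy a s) :=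
  measurable_realization_iff.2 fun n => (measurable_chainDensity ha n).mul (hs n)

/-- The event that the points with index less than `n` occur by time `c`. -/
def reached (t : ℕ → Ω → ℝ≥0∞) (c : ℝ≥0∞) (n : ℕ) : Set Ω := {ω | ∀ k < n, t k ω ≤ c}

lemma measurableSet_reached {t : ℕ → Ω → ℝ≥0∞} (ht : ∀ k, Measurable (t k)) (c : ℝ≥0∞) (n : ℕ) :
    MeasurableSet (reached t c n) := by
  have : reached t c n = ⋂ k, ⋂ (_ : k < n), {ω | t k ω ≤ c} := by
    ext ω; simp [reached]
  rw [this]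
  exact MeasurableSet.iInter fun k => MeasurableSet.iInter fun _ =>
    measurableSet_le (ht k) measurable_const

/-- The points with index less than `n`. -/
def firstPoints (x : ℕ → Ω → X) (n : ℕ) (ω : Ω) : Fin n → X := fun k => x k ω

lemma measurable_firstPoints {x : ℕ → Ω → X} (hx : ∀ k, Measurable (x k)) (n : ℕ) :
    Measurable (firstPoints x n) := measurable_pi_lambda _ fun _ => hx _

/-- The joint density of the first `n` points, on the event that they occur by time `c`, is the
product of the conditional densities of each point given the points before it. -/
lemma map_firstPoints_eq_withDensity (P : Measure Ω) [IsProbabilityMeasure P] (c : ℝ≥0∞)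
    {t : ℕ → Ω → ℝ≥0∞} {x : ℕ → Ω → X} (hx : ∀ k, Measurable (x k))
    (κ : Measure X) [SigmaFinite κ] {a : (n : ℕ) → (Fin n → X) → X → ℝ≥0∞}
    (ha : ∀ n, Measurable (Function.uncurry (a n)))
    (hnext : ∀ n (B : Set (Fin n → X)) (C : Set X), MeasurableSet B → MeasurableSet C →
      P (reached t c (n + 1) ∩ (firstPoints x n ⁻¹' B ∩ x n ⁻¹' C))
        = ∫⁻ ω in reached t c n ∩ firstPoints x n ⁻¹' B, ∫⁻ y in C, a n (firstPoints x n ω) y ∂κ ∂P)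
    (n : ℕ) :
    (P.restrict (reached t c n)).map (firstPoints x n)
      = (Measure.pi fun _ : Fin n => κ).withDensity (chainDensity a n) := by
  induction n with
  | zero =>
    rw [Measure.pi_of_empty]
    have h1 : reached t c 0 = Set.univ := by ext; simp [reached]
    have h2 : chainDensity a 0 = 1 := by ext; simp [chainDensity]
    have h3 : firstPoints x 0 = fun _ => isEmptyElim := by ext _ k; exact k.elim0
    rw [h1, h2, h3, Measure.restrict_univ, withDensity_one, Measure.map_const]
    simp
  | succ n ih =>
    let e := MeasurableEquiv.piFinSuccAbove (fun _ : Fin (n + 1) => X) (Fin.last n)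
    have he : ∀ y, e y = (y (Fin.last n), Fin.init y) := fun y => by
      simp only [e, MeasurableEquiv.piFinSuccAbove_apply, Fin.insertNthEquiv_symm_apply,
        Fin.removeNth_last]
    have hmp := measurePreserving_piFinSuccAbove (fun _ : Fin (n + 1) => κ) (Fin.last n)
    apply e.map_measurableEquiv_injective
    have : IsFiniteMeasure (((P.restrict (reached t c (n + 1))).map (firstPoints x (n + 1))).map e)
      := Measure.isFiniteMeasure_map _ _
    refine Measure.ext_prod fun {C B} hC hB => ?_
    have hS : MeasurableSet (e ⁻¹' (C ×ˢ B)) := e.measurable (hC.prod hB)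
    have hD := measurable_chainDensity ha n
    have hg : Measurable fun h => ∫⁻ y in C, a n h y ∂κ := (ha n).lintegral_prod_right'
    rw [Measure.map_apply e.measurable (hC.prod hB), Measure.map_apply e.measurable (hC.prod hB),
      Measure.map_apply (measurable_firstPoints hx _) hS,
      Measure.restrict_apply (measurable_firstPoints hx _ hS), withDensity_apply _ hS]
    have h1 : firstPoints x (n + 1) ⁻¹' (e ⁻¹' (C ×ˢ B)) ∩ reached t c (n + 1)
        = reached t c (n + 1) ∩ (firstPoints x n ⁻¹' B ∩ x n ⁻¹' C) := by
      ext ω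
      have : (Fin.init (firstPoints x (n + 1) ω) : Fin n → X) = firstPoints x n ω := rfl
      simp only [Set.mem_inter_iff, Set.mem_preimage, he, Set.mem_prod, this]
      have : firstPoints x (n + 1) ω (Fin.last n) = x n ω := rfl
      rw [this]; tauto
    have h2 : ∀ y, chainDensity a (n + 1) y = chainDensity a n (e y).2 * a n (e y).2 (e y).1 := by
      intro y; rw [chainDensity_succ, he]
    rw [h1, hnext n B C hB hC]
    simp_rw [h2]
    have hm : Measurable fun z : X × (Fin n → X) => chainDensity a n z.2 * a n z.2 z.1 :=
      (hD.comp measurable_snd).mul ((ha n).comp measurable_swap)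
    rw [hmp.setLIntegral_comp_preimage (hC.prod hB) hm, setLIntegral_prod_symm _ hm.aemeasurable]
    have hmr : (P.restrict (reached t c n ∩ firstPoints x n ⁻¹' B))
        = (P.restrict (reached t c n)).restrict (firstPoints x n ⁻¹' B) := by
      rw [Measure.restrict_restrict (measurable_firstPoints hx n hB), Set.inter_comm]
    rw [hmr, ← setLIntegral_map hB hg (measurable_firstPoints hx n), ih,
      setLIntegral_withDensity_eq_setLIntegral_mul _ hD hg hB]
    refine setLIntegral_congr_fun hB fun h _ => ?_
    exact (lintegral_const_mul _ ((ha n).comp measurable_prodMk_left)).symm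

/-- The law of the realization on `[0, T]` of sequentially generated points. -/
theorem map_observe_eq_withDensity (P : Measure Ω) [IsProbabilityMeasure P] (T : ℝ)
    {t : ℕ → Ω → ℝ≥0∞} (ht : ∀ k, Measurable (t k)) {x : ℕ → Ω → X} (hx : ∀ k, Measurable (x k))
    (hmono : ∀ᵐ ω ∂P, Monotone fun k => t k ω)
    (hfin : ∀ᵐ ω ∂P, {k | t k ω ≤ ENNReal.ofReal T}.Finite)
    (κ : Measure X) [SigmaFinite κ] {a : (n : ℕ) → (Fin n → X) → X → ℝ≥0∞}
    (ha : ∀ n, Measurable (Function.uncurry (a n))) {s : (n : ℕ) → (Fin n → X) → ℝ≥0∞}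
    (hs : ∀ n, Measurable (s n))
    (hnext : ∀ n (B : Set (Fin n → X)) (C : Set X), MeasurableSet B → MeasurableSet C →
      P (reached t (ENNReal.ofReal T) (n + 1) ∩ (firstPoints x n ⁻¹' B ∩ x n ⁻¹' C))
        = ∫⁻ ω in reached t (ENNReal.ofReal T) n ∩ firstPoints x n ⁻¹' B,
            ∫⁻ y in C, a n (firstPoints x n ω) y ∂κ ∂P)
    (hlast : ∀ n (B : Set (Fin n → X)), MeasurableSet B →
      P (reached t (ENNReal.ofReal T) n ∩ firstPoints x n ⁻¹' B ∩
          {ω | ENNReal.ofReal T < t n ω})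
        = ∫⁻ ω in reached t (ENNReal.ofReal T) n ∩ firstPoints x n ⁻¹' B,
            s n (firstPoints x n ω) ∂P) :
    P.map (fun ω => observe T (fun k => t k ω) fun k => x k ω)
      = (realizationMeasure κ).withDensity (janossy a s) := by
  set c := ENNReal.ofReal T
  ext A hA
  have hmA : ∀ n, MeasurableSet (realizationOf n ⁻¹' A) := measurableSet_realization_iff.1 hA
  rw [Measure.map_apply (measurable_observe T ht hx) hA, observe_preimage, measure_iUnion,
    withDensity_apply _ hA, realizationMeasure, Measure.restrict_sum _ hA,
    lintegral_sum_measure]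
  rotate_left
  · intro i j hij
    refine Set.disjoint_left.2 fun ω hi hj => hij ?_
    exact hi.1.symm.trans hj.1
  · intro n
    exact (measurable_ncard_le ht _ (measurableSet_singleton n)).inter
      (measurable_firstPoints hx n (hmA n))
  refine tsum_congr fun n => ?_
  have h1 : P ({ω | {k : ℕ | t k ω ≤ c}.ncard = n} ∩
      {ω | (fun k : Fin n => x k ω) ∈ realizationOf n ⁻¹' A})
      = P (reached t c n ∩ firstPoints x n ⁻¹' (realizationOf n ⁻¹' A) ∩ {ω | c < t n ω}) := by
    refine measure_congr ?_
    filter_upwards [hmono, hfin] with ω h1 h2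
    have := ncard_le_eq_iff h1 h2 n
    refine propext ⟨fun h => ?_, fun h => ?_⟩
    · exact ⟨⟨(this.1 h.1).1, h.2⟩, (this.1 h.1).2⟩
    · exact ⟨this.2 ⟨h.1.1, h.2⟩, h.1.2⟩
  have hmr : (P.restrict (reached t c n ∩ firstPoints x n ⁻¹' (realizationOf n ⁻¹' A)))
      = (P.restrict (reached t c n)).restrict (firstPoints x n ⁻¹' (realizationOf n ⁻¹' A)) := by
    rw [Measure.restrict_restrict (measurable_firstPoints hx n (hmA n)), Set.inter_comm]
  rw [h1, hlast n _ (hmA n), hmr, ← setLIntegral_map (hmA n) (hs n) (measurable_firstPoints hx n),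
    map_firstPoints_eq_withDensity P c hx κ ha hnext n,
    setLIntegral_withDensity_eq_setLIntegral_mul _ (measurable_chainDensity ha n) (hs n) (hmA n),
    setLIntegral_map hA (measurable_janossy ha hs) (measurable_realization_mk n)]
  rfl

end Chain

/-! ### The unit rate Poisson process -/

section Poisson

/-- The last of `n` times, and `0` if there is none. -/
def lastTime : (n : ℕ) → (Fin n → ℝ) → ℝ
  | 0, _ => 0
  | n + 1, x => x (Fin.last n)

lemma measurable_lastTime (n : ℕ) : Measurable (lastTime n) := by
  cases n with
  | zero => exact measurable_const
  | succ n => exact measurable_pi_apply _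

lemma measurable_exponentialPDF' (r : ℝ) : Measurable (exponentialPDF r) :=
  (measurable_exponentialPDFReal r).ennreal_ofReal

lemma measurable_arrivalTime (k : ℕ) : Measurable fun w : ℕ → ℝ => arrivalTime w k :=
  Finset.measurable_sum _ fun _ _ => measurable_pi_apply _

/-- The law of the inter-arrival times of the unit rate Poisson process. -/
abbrev waitingLaw : Measure (ℕ → ℝ) := Measure.infinitePi fun _ : ℕ => expMeasure 1

/-- The arrival times as a sequence of random variables on the space of inter-arrival times. -/
abbrev arrivals : ℕ → (ℕ → ℝ) → ℝ := fun k w => arrivalTime w k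

lemma arrivalTime_eq (w : ℕ → ℝ) (n : ℕ) :
    arrivalTime w n = lastTime n (firstPoints arrivals n w) + w n := by
  cases n with
  | zero => simp [arrivalTime, lastTime]
  | succ n => simp [arrivalTime, lastTime, firstPoints, Finset.sum_range_succ]

lemma indepFun_arrivals (n : ℕ) :
    IndepFun (firstPoints arrivals n) (fun w => w n) waitingLaw := by
  have h0 : iIndepFun (fun (i : ℕ) (w : ℕ → ℝ) => w i) waitingLaw :=
    iIndepFun_infinitePi (P := fun _ : ℕ => expMeasure 1) (X := fun _ x => x)
      fun _ => measurable_id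
  have h1 := h0.indepFun_finset (Finset.range n) {n} (by simp) fun i => measurable_pi_apply i
  let φ : (Finset.range n → ℝ) → Fin n → ℝ := fun u k =>
    ∑ l : Finset.range n, if (l : ℕ) ≤ k then u l else 0
  have hφ : Measurable φ := by
    refine measurable_pi_lambda _ fun k => Finset.measurable_sum _ fun l _ => ?_
    split_ifs
    · exact measurable_pi_apply _
    · exact measurable_const
  have h2 := h1.comp hφ (measurable_pi_apply (⟨n, Finset.mem_singleton_self n⟩ : ({n} : Finset ℕ)))
  convert h2 using 1
  swap
  · rfl
  ext w k
  simp only [firstPoints, arrivalTime, Function.comp_apply, φ]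
  rw [Finset.sum_coe_sort (Finset.range n) fun l => if l ≤ (k : ℕ) then w l else 0,
    ← Finset.sum_filter]
  refine Finset.sum_congr ?_ fun _ _ => rfl
  ext l
  simp only [Finset.mem_range, Finset.mem_filter]
  have := k.2
  lia

/-- Given the first `n` arrivals, the next one has an exponential density after the last of them. -/
lemma lintegral_arrivals (n : ℕ) {φ : (Fin n → ℝ) × ℝ → ℝ≥0∞} (hφ : Measurable φ) :
    ∫⁻ w, φ (firstPoints arrivals n w, arrivalTime w n) ∂waitingLaw
      = ∫⁻ w, (∫⁻ y, φ (firstPoints arrivals n w, y) *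
          exponentialPDF 1 (y - lastTime n (firstPoints arrivals n w))) ∂waitingLaw := by
  have hH : Measurable (firstPoints arrivals n) := measurable_firstPoints measurable_arrivalTime n
  have hw : Measurable fun w : ℕ → ℝ => w n := measurable_pi_apply n
  have hL := measurable_lastTime n
  have hmap := (indepFun_iff_map_prod_eq_prod_map_map hH.aemeasurable hw.aemeasurable).1
    (indepFun_arrivals n)
  rw [Measure.infinitePi_map_eval] at hmap
  have hm : Measurable fun z : (Fin n → ℝ) × ℝ => φ (z.1, lastTime n z.1 + z.2) :=
    hφ.comp (measurable_fst.prodMk ((hL.comp measurable_fst).add measurable_snd))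
  have hm2 : Measurable fun h => ∫⁻ y, φ (h, y) * exponentialPDF 1 (y - lastTime n h) :=
    Measurable.lintegral_prod_right' (f := fun z : (Fin n → ℝ) × ℝ =>
      φ z * exponentialPDF 1 (z.2 - lastTime n z.1))
      (hφ.mul ((measurable_exponentialPDF' 1).comp
        (measurable_snd.sub (hL.comp measurable_fst))))
  simp_rw [arrivalTime_eq]
  have := lintegral_map (μ := waitingLaw) hm (hH.prodMk hw)
  rw [← this, hmap, lintegral_prod _ hm.aemeasurable, ← lintegral_map hm2 hH]
  refine lintegral_congr fun h => ?_
  have he : expMeasure 1 = volume.withDensity (exponentialPDF 1) := rfl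
  have hmh : Measurable fun y => φ (h, lastTime n h + y) := hm.comp measurable_prodMk_left
  dsimp only
  rw [he, lintegral_withDensity_eq_lintegral_mul _ (measurable_exponentialPDF' 1) hmh,
    ← lintegral_add_left_eq_self (fun y => φ (h, y) * _) (lastTime n h)]
  refine lintegral_congr fun y => ?_
  simp [mul_comm]

lemma lintegral_exponentialPDF_Ioi {x : ℝ} (hx : 0 ≤ x) :
    ∫⁻ y in Set.Ioi x, exponentialPDF 1 y = ENNReal.ofReal (Real.exp (-x)) := by
  have h1 := lintegral_add_compl (exponentialPDF 1) (measurableSet_Iic (a := x)) (μ := volume)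
  rw [lintegral_exponentialPDF_eq_one one_pos, lintegral_exponentialPDF_eq_antiDeriv one_pos,
    if_pos hx, Set.compl_Iic, one_mul] at h1
  have h3 : (0 : ℝ) ≤ 1 - Real.exp (-x) := by
    have := Real.exp_le_one_iff.2 (neg_nonpos.2 hx)
    linarith
  have h2 : ENNReal.ofReal (1 - Real.exp (-x)) + ENNReal.ofReal (Real.exp (-x)) = 1 := by
    rw [← ENNReal.ofReal_add h3 (Real.exp_pos _).le]
    simp
  exact (ENNReal.add_right_inj ENNReal.ofReal_ne_top).1 (h1.trans h2.symm)

lemma lintegral_exponentialPDF_sub_Ioi {T c : ℝ} (h : c ≤ T) :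
    ∫⁻ y in Set.Ioi T, exponentialPDF 1 (y - c) = ENNReal.ofReal (Real.exp (-(T - c))) := by
  rw [← lintegral_exponentialPDF_Ioi (sub_nonneg.2 h), ← lintegral_indicator measurableSet_Ioi,
    ← lintegral_indicator measurableSet_Ioi,
    ← lintegral_sub_right_eq_self ((Set.Ioi (T - c)).indicator _) c]
  refine lintegral_congr fun y => ?_
  simp [Set.indicator_apply]

lemma ae_waiting_pos : ∀ᵐ w ∂waitingLaw, ∀ k, 0 < w k := by
  rw [ae_all_iff]
  intro k
  have h : ∀ᵐ y ∂expMeasure 1, 0 < y := by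
    have he : expMeasure 1 = volume.withDensity (exponentialPDF 1) := rfl
    rw [he, ae_withDensity_iff (measurable_exponentialPDF' 1)]
    filter_upwards [compl_mem_ae_iff.2 (Real.volume_singleton (a := 0))] with y hy0 hy
    rcases lt_trichotomy y 0 with h | h | h
    · exact absurd (exponentialPDF_of_neg h) hy
    · exact absurd h hy0
    · exact h
  rw [← Measure.infinitePi_map_eval (fun _ : ℕ => expMeasure 1) k] at h
  exact ae_of_ae_map (measurable_pi_apply k).aemeasurable h

lemma lintegral_exp_neg_expMeasure :
    ∫⁻ y, ENNReal.ofReal (Real.exp (-y)) ∂expMeasure 1 = 2⁻¹ := by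
  have he : expMeasure 1 = volume.withDensity (exponentialPDF 1) := rfl
  rw [he, lintegral_withDensity_eq_lintegral_mul _ (measurable_exponentialPDF' 1) (by fun_prop)]
  have : ∀ y, (exponentialPDF 1 * fun y => ENNReal.ofReal (Real.exp (-y))) y
      = 2⁻¹ * exponentialPDF 2 y := by
    intro y
    have h2 : (2⁻¹ : ℝ≥0∞) = ENNReal.ofReal 2⁻¹ := by
      rw [ENNReal.ofReal_inv_of_pos two_pos]; simp
    rw [Pi.mul_apply, exponentialPDF_eq, exponentialPDF_eq, h2, ← ENNReal.ofReal_mul' (by positivity),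
      ← ENNReal.ofReal_mul (by norm_num)]
    split_ifs
    · rw [one_mul, one_mul, ← Real.exp_add]; congr 1; ring_nf
    · simp
  simp_rw [this]
  rw [lintegral_const_mul _ (measurable_exponentialPDF' 2),
    lintegral_exponentialPDF_eq_one two_pos, mul_one]

lemma lintegral_exp_neg_arrivalTime (n : ℕ) :
    ∫⁻ w, ENNReal.ofReal (Real.exp (-arrivalTime w n)) ∂waitingLaw = 2⁻¹ ^ (n + 1) := by
  have hw : ∀ k, ∫⁻ w : ℕ → ℝ, ENNReal.ofReal (Real.exp (-w k)) ∂waitingLaw = 2⁻¹ := by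
    intro k
    rw [← lintegral_exp_neg_expMeasure,
      ← Measure.infinitePi_map_eval (fun _ : ℕ => expMeasure 1) k,
      lintegral_map (by fun_prop) (measurable_pi_apply k)]
  have hf : Measurable fun y : ℝ => ENNReal.ofReal (Real.exp (-y)) := by fun_prop
  have step : ∀ n, ∫⁻ w, ENNReal.ofReal (Real.exp (-arrivalTime w n)) ∂waitingLaw
      = (∫⁻ w, ENNReal.ofReal (Real.exp (-lastTime n (firstPoints arrivals n w))) ∂waitingLaw)
        * 2⁻¹ := by
    intro n
    have hind := (indepFun_arrivals n).comp (hf.comp (measurable_lastTime n)) hf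
    have hH : Measurable (firstPoints arrivals n) := measurable_firstPoints measurable_arrivalTime n
    rw [← hw n]
    refine Eq.trans ?_ (lintegral_mul_eq_lintegral_mul_lintegral_of_indepFun
      ((hf.comp (measurable_lastTime n)).comp hH) (hf.comp (measurable_pi_apply n)) hind)
    refine lintegral_congr fun w => ?_
    rw [arrivalTime_eq, neg_add, Real.exp_add, ENNReal.ofReal_mul (Real.exp_pos _).le]
    rfl
  induction n with
  | zero => rw [step]; simp [lastTime]
  | succ n ih =>
    rw [step, pow_succ, ← ih]
    rfl

/-- Arrivals do not accumulate: the expectations `2⁻⁽ᵏ⁺¹⁾` of `exp (-arrivalTime w k)` are summable, so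
Markov's inequality and the Borel–Cantelli lemma apply. -/
lemma ae_finite_arrivals (T : ℝ) :
    ∀ᵐ w ∂waitingLaw, {k | ENNReal.ofReal (arrivalTime w k) ≤ ENNReal.ofReal T}.Finite := by
  have hbound : ∀ k, waitingLaw {w | ENNReal.ofReal (Real.exp (-(max T 0)))
      ≤ ENNReal.ofReal (Real.exp (-arrivalTime w k))}
      ≤ (ENNReal.ofReal (Real.exp (-(max T 0))))⁻¹ * 2⁻¹ ^ (k + 1) := by
    intro k
    have h := mul_meas_ge_le_lintegral (μ := waitingLaw)
      (f := fun w => ENNReal.ofReal (Real.exp (-arrivalTime w k)))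
      (by have := measurable_arrivalTime k; fun_prop) (ENNReal.ofReal (Real.exp (-(max T 0))))
    rw [lintegral_exp_neg_arrivalTime] at h
    have h0 : ENNReal.ofReal (Real.exp (-(max T 0))) ≠ 0 := by
      simp [Real.exp_pos]
    rw [← ENNReal.div_eq_inv_mul]
    exact ENNReal.le_div_iff_mul_le (Or.inl h0) (Or.inl ENNReal.ofReal_ne_top) |>.2
      (by rwa [mul_comm])
  have hsum : ∑' k, waitingLaw {w | ENNReal.ofReal (Real.exp (-(max T 0)))
      ≤ ENNReal.ofReal (Real.exp (-arrivalTime w k))} ≠ ∞ := by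
    refine ne_top_of_le_ne_top ?_ (ENNReal.tsum_le_tsum hbound)
    rw [ENNReal.tsum_mul_left, ENNReal.tsum_geometric_add_one]
    refine ENNReal.mul_ne_top ?_ ?_
    · simp [Real.exp_pos]
    · simp
  filter_upwards [ae_finite_setOfPred_mem hsum] with w hw
  refine hw.subset fun k hk => ?_
  refine ENNReal.ofReal_le_ofReal (Real.exp_le_exp.2 (neg_le_neg ?_))
  have : ENNReal.ofReal (arrivalTime w k) ≤ ENNReal.ofReal T := hk
  rcases le_total (arrivalTime w k) 0 with h | h
  · exact h.trans (le_max_right _ _)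
  · by_contra! h'
    have h1 : T < arrivalTime w k := (le_max_left _ _).trans_lt h'
    have h2 : 0 < arrivalTime w k := (le_max_right _ _).trans_lt h'
    exact absurd this (not_le.2 ((ENNReal.ofReal_lt_ofReal_iff h2).2 h1))

/-- The density of the next arrival time of the unit rate Poisson process by time `T`. -/
def poissonNext (T : ℝ) (n : ℕ) (x : Fin n → ℝ) (y : ℝ) : ℝ≥0∞ :=
  (Set.Iic T).indicator (fun y => exponentialPDF 1 (y - lastTime n x)) y

/-- The probability that the unit rate Poisson process has no further arrival by time `T`. -/
def poissonLast (T : ℝ) (n : ℕ) (x : Fin n → ℝ) : ℝ≥0∞ :=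
  ENNReal.ofReal (Real.exp (-(T - lastTime n x)))

lemma measurable_poissonNext (T : ℝ) (n : ℕ) :
    Measurable (Function.uncurry (poissonNext T n)) := by
  have h : Measurable fun z : (Fin n → ℝ) × ℝ => exponentialPDF 1 (z.2 - lastTime n z.1) :=
    (measurable_exponentialPDF' 1).comp
      (measurable_snd.sub ((measurable_lastTime n).comp measurable_fst))
  exact h.indicator (measurable_snd measurableSet_Iic)

lemma measurable_poissonLast (T : ℝ) (n : ℕ) : Measurable (poissonLast T n) := by
  have := measurable_lastTime n
  unfold poissonLast
  fun_prop

lemma unitPoissonLaw_eq_withDensity {T : ℝ} (hT : 0 ≤ T) :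
    unitPoissonLaw T
      = (realizationMeasure volume).withDensity (janossy (poissonNext T) (poissonLast T)) := by
  have ht : ∀ k, Measurable fun w : ℕ → ℝ => ENNReal.ofReal (arrivalTime w k) := fun k =>
    (measurable_arrivalTime k).ennreal_ofReal
  have hle : ∀ (w : ℕ → ℝ) k,
      ENNReal.ofReal (arrivalTime w k) ≤ ENNReal.ofReal T ↔ arrivalTime w k ≤ T :=
    fun w k => ENNReal.ofReal_le_ofReal_iff hT
  have hH : ∀ n, Measurable (firstPoints arrivals n) :=
    measurable_firstPoints measurable_arrivalTime
  have hR : ∀ n, MeasurableSet {x : Fin n → ℝ | ∀ k, x k ≤ T} := fun n => by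
    have : {x : Fin n → ℝ | ∀ k, x k ≤ T} = ⋂ k, {x | x k ≤ T} := by ext; simp
    rw [this]
    exact MeasurableSet.iInter fun k => measurableSet_le (measurable_pi_apply k) measurable_const
  have hreach : ∀ n, reached (fun k w => ENNReal.ofReal (arrivalTime w k)) (ENNReal.ofReal T) n
      = firstPoints arrivals n ⁻¹' {x | ∀ k, x k ≤ T} := by
    intro n
    ext w
    exact ⟨fun h k => (hle w k).1 (h k k.2), fun h k hk => (hle w k).2 (h ⟨k, hk⟩)⟩
  have hlastT : ∀ n (x : Fin n → ℝ), (∀ k, x k ≤ T) → lastTime n x ≤ T := by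
    intro n x hx
    cases n with
    | zero => exact hT
    | succ n => exact hx _
  -- the renewal property, integrated over the event that the points before satisfy `B`
  have key : ∀ n (B : Set (Fin n → ℝ)) (D : Set ℝ), MeasurableSet B → MeasurableSet D →
      waitingLaw {w | firstPoints arrivals n w ∈ B ∧ arrivalTime w n ∈ D}
        = ∫⁻ w in firstPoints arrivals n ⁻¹' B,
            (∫⁻ y in D, exponentialPDF 1 (y - lastTime n (firstPoints arrivals n w))) ∂waitingLaw := by
    intro n B D hB hD
    have := lintegral_arrivals n (φ := (B ×ˢ D).indicator 1)
      (measurable_one.indicator (hB.prod hD))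
    have h1 : ∫⁻ w, (B ×ˢ D).indicator 1 (firstPoints arrivals n w, arrivalTime w n) ∂waitingLaw
        = waitingLaw {w | firstPoints arrivals n w ∈ B ∧ arrivalTime w n ∈ D} := by
      exact (lintegral_indicator_one (μ := waitingLaw)
        (((hH n) hB).inter (measurable_arrivalTime n hD)))
    rw [← h1, this, ← lintegral_indicator (hH n hB)]
    refine lintegral_congr fun w => ?_
    by_cases hw : firstPoints arrivals n w ∈ B
    · rw [Set.indicator_of_mem (show w ∈ firstPoints arrivals n ⁻¹' B from hw),
        ← lintegral_indicator hD]
      refine lintegral_congr fun y => ?_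
      by_cases hy : y ∈ D <;> simp [hw, hy]
    · rw [Set.indicator_of_notMem (show w ∉ firstPoints arrivals n ⁻¹' B from hw)]
      simp [hw]
  refine map_observe_eq_withDensity waitingLaw T ht measurable_arrivalTime ?_
    (ae_finite_arrivals T) volume (measurable_poissonNext T) (measurable_poissonLast T) ?_ ?_
  · filter_upwards [ae_waiting_pos] with w hw
    refine monotone_nat_of_le_succ fun k => ENNReal.ofReal_le_ofReal ?_
    rw [arrivalTime, arrivalTime, Finset.sum_range_succ _ (k + 1)]
    linarith [hw (k + 1)]
  · intro n B C hB hC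
    rw [hreach n, ← Set.preimage_inter]
    simp only [poissonNext]
    simp_rw [setLIntegral_indicator measurableSet_Iic]
    rw [← key n _ _ ((hR n).inter hB) (measurableSet_Iic.inter hC)]
    congr 1
    ext w
    simp only [reached, Set.mem_inter_iff, Set.mem_preimage, Set.mem_ofPred_eq, Set.mem_Iic,
      Nat.lt_succ_iff, hle]
    constructor
    · rintro ⟨h1, h2, h3⟩
      exact ⟨⟨fun k => h1 k k.2.le, h2⟩, h1 n le_rfl, h3⟩
    · rintro ⟨⟨h1, h2⟩, h3, h4⟩
      refine ⟨fun k hk => ?_, h2, h4⟩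
      rcases hk.lt_or_eq with h | rfl
      · exact h1 ⟨k, h⟩
      · exact h3
  · intro n B hB
    rw [hreach n, ← Set.preimage_inter]
    have h1 := key n _ _ ((hR n).inter hB) (measurableSet_Ioi (a := T))
    have h2 : ∀ w, ENNReal.ofReal T < ENNReal.ofReal (arrivalTime w n) ↔ T < arrivalTime w n :=
      fun w => by rw [← not_le, hle, not_le]
    simp_rw [h2]
    refine Eq.trans (by rfl) (h1.trans ?_)
    refine setLIntegral_congr_fun (hH n ((hR n).inter hB)) fun w hw => ?_
    exact lintegral_exponentialPDF_sub_Ioi (hlastT n _ hw.1)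

/-- The exponential densities of the inter-arrival times telescope. -/
lemma chainDensity_poissonNext {T : ℝ} (n : ℕ) (x : Fin n → ℝ) (hmono : StrictMono x)
    (hpos : ∀ k, 0 < x k) (hle : ∀ k, x k ≤ T) :
    chainDensity (poissonNext T) n x = ENNReal.ofReal (Real.exp (-lastTime n x)) := by
  induction n with
  | zero => simp [chainDensity, lastTime]
  | succ n ih =>
    have h1 : lastTime n (Fin.init x) ≤ x (Fin.last n) := by
      cases n with
      | zero => exact (hpos _).le
      | succ n => exact (hmono (Fin.castSucc_lt_last _)).le
    rw [chainDensity_succ, ih (Fin.init x) (fun i j h => hmono (Fin.castSucc_lt_castSucc_iff.2 h))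
      (fun k => hpos _) (fun k => hle _), poissonNext, Set.indicator_of_mem (Set.mem_Iic.2 (hle _)),
      exponentialPDF_of_nonneg (sub_nonneg.2 h1), one_mul, one_mul,
      ← ENNReal.ofReal_mul (Real.exp_pos _).le, ← Real.exp_add]
    congr 2
    simp only [lastTime]
    ring

/-- The likelihood of the unit rate Poisson process is `exp (-T)` at almost all chronological lists
of times in `(0, T]`. -/
lemma ae_unitPoissonLikelihood {T : ℝ} (hT : 0 ≤ T) :
    ∀ᵐ r ∂realizationMeasure (volume : Measure ℝ),
      StrictMono r.2 → (∀ k, 0 < r.2 k ∧ r.2 k ≤ T) →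
        unitPoissonLikelihood T r = ENNReal.ofReal (Real.exp (-T)) := by
  have h := Measure.rnDeriv_withDensity (realizationMeasure (volume : Measure ℝ))
    (measurable_janossy (measurable_poissonNext T) (measurable_poissonLast T))
  rw [← unitPoissonLaw_eq_withDensity hT] at h
  filter_upwards [h] with r hr hmono hpos
  rw [unitPoissonLikelihood, hr, janossy, chainDensity_poissonNext r.1 r.2 hmono
    (fun k => (hpos k).1) (fun k => (hpos k).2), poissonLast,
    ← ENNReal.ofReal_mul (Real.exp_pos _).le, ← Real.exp_add]
  congr 2
  ring

end Poisson

/-! ### Exponentials of cumulative hazards -/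

section Hazard

lemma lipschitzOnWith_comp_absolutelyContinuousOnInterval {f g : ℝ → ℝ} {a b : ℝ} {K : NNReal}
    {s : Set ℝ} (hf : AbsolutelyContinuousOnInterval f a b) (hg : LipschitzOnWith K g s)
    (hs : Set.MapsTo f (Set.uIcc a b) s) : AbsolutelyContinuousOnInterval (g ∘ f) a b := by
  rw [absolutelyContinuousOnInterval_iff] at hf ⊢
  intro ε hε
  obtain ⟨δ, hδ, h⟩ := hf (ε / (K + 1)) (by positivity)
  refine ⟨δ, hδ, fun E hE hlt => ?_⟩
  have h1 := h E hE hlt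
  have hmem : ∀ i ∈ Finset.range E.1, (E.2 i).1 ∈ Set.uIcc a b ∧ (E.2 i).2 ∈ Set.uIcc a b := by
    intro i hi
    exact hE.1 i hi
  calc ∑ i ∈ Finset.range E.1, dist ((g ∘ f) (E.2 i).1) ((g ∘ f) (E.2 i).2)
      ≤ ∑ i ∈ Finset.range E.1, K * dist (f (E.2 i).1) (f (E.2 i).2) :=
        Finset.sum_le_sum fun i hi => hg.dist_le_mul _ (hs (hmem i hi).1) _ (hs (hmem i hi).2)
    _ = K * ∑ i ∈ Finset.range E.1, dist (f (E.2 i).1) (f (E.2 i).2) := by rw [Finset.mul_sum]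
    _ ≤ K * (ε / (K + 1)) := by gcongr
    _ < (K + 1) * (ε / (K + 1)) := by gcongr; linarith
    _ = ε := by field_simp

/-- The identity `∫₀ʳ a exp(A) + 1 = exp(A r)` for the primitive `A` of a nonnegative locally
integrable function `a`. -/
lemma lintegral_mul_exp_primitive {a : ℝ → ℝ≥0∞} (ha : Measurable a) {r : ℝ} (hr : 0 ≤ r)
    (hfin : ∫⁻ u in Set.Ioc 0 r, a u ≠ ∞) :
    (∫⁻ u in Set.Ioc 0 r, a u * ENNReal.ofReal (Real.exp (∫⁻ v in Set.Ioc 0 u, a v).toReal)) + 1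
      = ENNReal.ofReal (Real.exp (∫⁻ v in Set.Ioc 0 r, a v).toReal) := by
  set f : ℝ → ℝ := fun u => (a u).toReal with hf
  set A : ℝ → ℝ := fun u => ∫ v in (0 : ℝ)..u, f v with hA
  have hint : IntervalIntegrable f volume 0 r := by
    rw [intervalIntegrable_iff_integrableOn_Ioc_of_le hr]
    exact integrable_toReal_of_lintegral_ne_top ha.aemeasurable hfin
  have hAeq : ∀ u ∈ Set.Icc 0 r, (∫⁻ v in Set.Ioc 0 u, a v).toReal = A u := by
    intro u hu
    have hfu : ∫⁻ v in Set.Ioc 0 u, a v ≠ ∞ :=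
      ne_top_of_le_ne_top hfin (lintegral_mono_set (Set.Ioc_subset_Ioc_right hu.2))
    rw [hA]
    simp only [intervalIntegral.integral_of_le hu.1, hf]
    rw [integral_toReal ha.aemeasurable (ae_lt_top ha hfu)]
  have hAC : AbsolutelyContinuousOnInterval A 0 r :=
    hint.absolutelyContinuousOnInterval_intervalIntegral (by simp)
  obtain ⟨C, hC⟩ := hAC.exists_bound
  obtain ⟨K, hK⟩ := (Real.contDiff_exp.contDiffOn (n := 1) (s := Set.Icc (-C) C)
    ).exists_lipschitzOnWith (by decide) (convex_Icc _ _) isCompact_Icc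
  have hAC2 : AbsolutelyContinuousOnInterval (Real.exp ∘ A) 0 r :=
    lipschitzOnWith_comp_absolutelyContinuousOnInterval hAC hK fun x hx => abs_le.1 (hC x hx)
  have hFTC := hAC2.integral_deriv_eq_sub
  have hderiv : ∀ᵐ u, u ∈ Set.Ioc 0 r → deriv (Real.exp ∘ A) u = f u * Real.exp (A u) := by
    filter_upwards [hint.ae_hasDerivAt_integral] with u hu hmem
    have := (hu (by rw [Set.uIcc_of_le hr]; exact Set.Ioc_subset_Icc_self hmem) 0 (by simp)).exp
    rw [mul_comm]
    exact this.deriv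
  have hnn : ∀ u, 0 ≤ f u * Real.exp (A u) := fun u =>
    mul_nonneg ENNReal.toReal_nonneg (Real.exp_pos _).le
  have hI : IntegrableOn (fun u => f u * Real.exp (A u)) (Set.Ioc 0 r) := by
    have h := hAC2.intervalIntegrable_deriv
    rw [intervalIntegrable_iff_integrableOn_Ioc_of_le hr] at h
    exact h.congr ((ae_restrict_iff' measurableSet_Ioc).2 hderiv)
  rw [intervalIntegral.integral_of_le hr, setIntegral_congr_ae measurableSet_Ioc hderiv] at hFTC
  have hA0 : A 0 = 0 := by simp [hA]
  have hlt := ae_lt_top ha hfin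
  have hL : (∫⁻ u in Set.Ioc 0 r,
      a u * ENNReal.ofReal (Real.exp (∫⁻ v in Set.Ioc 0 u, a v).toReal))
      = ENNReal.ofReal (∫ u in Set.Ioc 0 r, f u * Real.exp (A u)) := by
    rw [ofReal_integral_eq_lintegral_ofReal hI (ae_of_all _ hnn)]
    refine lintegral_congr_ae ?_
    filter_upwards [hlt, ae_restrict_mem measurableSet_Ioc] with u hu hmem
    rw [hAeq u (Set.Ioc_subset_Icc_self hmem), ENNReal.ofReal_mul ENNReal.toReal_nonneg,
      ENNReal.ofReal_toReal hu.ne]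
  rw [hL, hFTC, hAeq r ⟨hr, le_rfl⟩]
  have h1 : (0 : ℝ) ≤ A r := by
    rw [← hAeq r ⟨hr, le_rfl⟩]; exact ENNReal.toReal_nonneg
  have h2 : (1 : ℝ) ≤ Real.exp (A r) := Real.one_le_exp h1
  simp only [Function.comp_apply, hA0, Real.exp_zero]
  rw [← ENNReal.ofReal_one, ← ENNReal.ofReal_add (by linarith) zero_le_one]
  congr 1
  ring

end Hazard

/-! ### The internal history -/

namespace MarkedPointProcess

variable {Ω : Type*} [MeasurableSpace Ω] (N : MarkedPointProcess Ω)

/-- The `k`-th event (time, side, mark). -/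
def point (k : ℕ) (ω : Ω) : ℝ × Fin 2 × ℝ := ((N.time k ω).toReal, N.side k ω, N.mark k ω)

lemma measurable_point (k : ℕ) : Measurable (N.point k) :=
  (N.measurable_time k).ennreal_toReal.prodMk ((N.measurable_side k).prodMk (N.measurable_mark k))

lemma monotone_time (ω : Ω) : Monotone fun k => N.time k ω :=
  monotone_nat_of_le_succ fun k => N.time_le k ω

lemma time_lt_of_lt {ω : Ω} {j k : ℕ} (hjk : j < k) (h : N.time j ω < ∞) :
    N.time j ω < N.time k ω :=
  (N.time_lt j ω h).trans_le (N.monotone_time ω hjk)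

lemma measurable_count (i : Fin 2) (s t : ℝ) {K : Set ℝ} (hK : MeasurableSet K) :
    Measurable (N.count i s t K) := by
  classical
  unfold count
  refine Measurable.tsum fun k => ?_
  refine Measurable.ite ?_ measurable_const measurable_const
  exact (measurableSet_lt measurable_const (N.measurable_time k)).inter
    ((measurableSet_le (N.measurable_time k) measurable_const).inter
      ((N.measurable_side k (measurableSet_singleton i)).inter (N.measurable_mark k hK)))

lemma history_le (s : ℝ) : N.history s ≤ ‹MeasurableSpace Ω› := by
  refine iSup_le fun i => iSup_le fun r => iSup_le fun _ => iSup_le fun K => iSup_le fun hK => ?_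
  exact (N.measurable_count i 0 r hK).comap_le

lemma measurable_count_history (i : Fin 2) {r q : ℝ} (hrq : r ≤ q) {K : Set ℝ}
    (hK : MeasurableSet K) : Measurable[N.history q] (N.count i 0 r K) := by
  have : MeasurableSpace.comap (N.count i 0 r K) inferInstance ≤ N.history q :=
    le_iSup_of_le i (le_iSup_of_le r (le_iSup_of_le hrq (le_iSup_of_le K
      (le_iSup_of_le hK le_rfl))))
  exact measurable_iff_comap_le.2 this

open Classical in
/-- If exactly the first `m` events happen by time `r`, the counts up to `r` are sums over these. -/
lemma count_eq_sum (i : Fin 2) {r : ℝ} (K : Set ℝ) {ω : Ω} {m : ℕ}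
    (h1 : ∀ k < m, N.time k ω ≤ ENNReal.ofReal r) (h2 : ENNReal.ofReal r < N.time m ω) :
    N.count i 0 r K ω
      = ∑ k ∈ Finset.range m, if N.side k ω = i ∧ N.mark k ω ∈ K then (1 : ℝ≥0∞) else 0 := by
  rw [count, tsum_eq_sum (s := Finset.range m)]
  · refine Finset.sum_congr rfl fun k hk => ?_
    simp [N.time_pos, h1 k (Finset.mem_range.1 hk)]
  · intro k hk
    rw [if_neg]
    rintro ⟨-, h, -⟩
    exact absurd (h2.trans_le (N.monotone_time ω (not_lt.1 (Finset.mem_range.not.1 hk))))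
      (not_lt.2 h)

lemma count_add_count (r : ℝ) (ω : Ω) [∀ k, Decidable (N.time k ω ≤ ENNReal.ofReal r)] :
    N.count 0 0 r Set.univ ω + N.count 1 0 r Set.univ ω
      = ∑' k, if N.time k ω ≤ ENNReal.ofReal r then (1 : ℝ≥0∞) else 0 := by
  rw [count, count, ← ENNReal.tsum_add]
  refine tsum_congr fun k => ?_
  by_cases h : N.time k ω ≤ ENNReal.ofReal r
  · have : N.side k ω = 0 ∨ N.side k ω = 1 := by lia
    rcases this with h' | h' <;> simp [N.time_pos, h, h']
  · simp [h]

lemma time_le_iff_count (k : ℕ) (r : ℝ) (ω : Ω) :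
    N.time k ω ≤ ENNReal.ofReal r
      ↔ ((k + 1 : ℕ) : ℝ≥0∞) ≤ N.count 0 0 r Set.univ ω + N.count 1 0 r Set.univ ω := by
  classical
  rw [count_add_count]
  constructor
  · intro h
    refine le_trans (le_of_eq ?_) (ENNReal.sum_le_tsum (Finset.range (k + 1)))
    rw [Finset.sum_congr rfl (g := fun _ => (1 : ℝ≥0∞))]
    · simp
    · intro j hj
      rw [if_pos ((N.monotone_time ω (Nat.lt_succ_iff.1 (Finset.mem_range.1 hj))).trans h)]
  · intro h
    by_contra! hlt
    have : ∑' j, (if N.time j ω ≤ ENNReal.ofReal r then (1 : ℝ≥0∞) else 0) ≤ k := by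
      rw [tsum_eq_sum (s := Finset.range k)]
      · refine (Finset.sum_le_card_nsmul _ _ 1 fun j _ => ?_).trans (by simp)
        split_ifs <;> simp
      · intro j hj
        rw [if_neg]
        exact not_le.2 (hlt.trans_le (N.monotone_time ω (not_lt.1 (Finset.mem_range.not.1 hj))))
    have h' := h.trans this
    rw [Nat.cast_le] at h'
    lia

lemma measurableSet_time_le_history (k : ℕ) {r q : ℝ} (hrq : r ≤ q) :
    MeasurableSet[N.history q] {ω | N.time k ω ≤ ENNReal.ofReal r} := by
  simp_rw [time_le_iff_count]
  exact measurableSet_le measurable_const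
    ((N.measurable_count_history 0 hrq .univ).add (N.measurable_count_history 1 hrq .univ))

/-- The side and the mark of an event are read off from the increment of the counts over a time
interval that contains this event only. -/
lemma measurableSet_side_mark_history (k : ℕ) (q : ℝ) (i : Fin 2) {K : Set ℝ}
    (hK : MeasurableSet K) :
    MeasurableSet[N.history q]
      {ω | N.time k ω ≤ ENNReal.ofReal q ∧ N.side k ω = i ∧ N.mark k ω ∈ K} := by
  classical
  let D : Set ℝ := {r | r ≤ q ∧ (r = q ∨ ∃ z : ℚ, (z : ℝ) = r)}
  have hD : D.Countable := by
    refine ((Set.countable_singleton q).union (Set.countable_range fun z : ℚ => (z : ℝ))).mono ?_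
    rintro r ⟨-, h | h⟩
    · exact Or.inl h
    · exact Or.inr h
  have hset : {ω | N.time k ω ≤ ENNReal.ofReal q ∧ N.side k ω = i ∧ N.mark k ω ∈ K}
      = ⋃ a ∈ D, ⋃ b ∈ D, ((⋂ j ∈ Finset.range k, {ω | N.time j ω ≤ ENNReal.ofReal a}) ∩
          {ω | N.time k ω ≤ ENNReal.ofReal a}ᶜ ∩ {ω | N.time k ω ≤ ENNReal.ofReal b} ∩
          {ω | N.time (k + 1) ω ≤ ENNReal.ofReal b}ᶜ ∩
          {ω | N.count i 0 b K ω = N.count i 0 a K ω + 1}) := by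
    ext ω
    simp only [Set.mem_iUnion, Set.mem_inter_iff, Set.mem_iInter, Set.mem_ofPred_eq,
      Set.mem_compl_iff, not_le, Finset.mem_range, exists_prop]
    -- the increment of the counts over an interval that contains the `k`-th event only
    have hinc : ∀ a b : ℝ, (∀ j < k, N.time j ω ≤ ENNReal.ofReal a) →
        ENNReal.ofReal a < N.time k ω → N.time k ω ≤ ENNReal.ofReal b →
        ENNReal.ofReal b < N.time (k + 1) ω →
        (N.count i 0 b K ω = N.count i 0 a K ω + 1 ↔ N.side k ω = i ∧ N.mark k ω ∈ K) := by
      intro a b h1 h2 h3 h4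
      rw [N.count_eq_sum i K h1 h2, N.count_eq_sum i K (m := k + 1)
        (fun j hj => (N.monotone_time ω (Nat.lt_succ_iff.1 hj)).trans h3) h4,
        Finset.sum_range_succ]
      have hfin : (∑ k ∈ Finset.range k, if N.side k ω = i ∧ N.mark k ω ∈ K then (1 : ℝ≥0∞) else 0)
          ≠ ∞ := by
        refine ENNReal.sum_ne_top.2 fun j _ => ?_
        split_ifs <;> simp
      rw [ENNReal.add_right_inj hfin]
      split_ifs with h <;> simp [h]
    constructor
    · rintro ⟨h1, h2⟩
      have hfin : N.time k ω < ∞ := h1.trans_lt ENNReal.ofReal_lt_top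
      have hq : 0 < q := by
        by_contra! h
        rw [ENNReal.ofReal_of_nonpos h] at h1
        exact absurd (N.time_pos k ω) (not_lt.2 h1)
      have ha : ∃ a ∈ D, (∀ j < k, N.time j ω ≤ ENNReal.ofReal a) ∧
          ENNReal.ofReal a < N.time k ω := by
        have hc : ∃ c < N.time k ω, ∀ j < k, N.time j ω ≤ c := by
          cases k with
          | zero => exact ⟨0, N.time_pos 0 ω, fun j hj => absurd hj (Nat.not_lt_zero j)⟩
          | succ k => exact ⟨N.time k ω, N.time_lt_of_lt k.lt_succ_self
              ((N.monotone_time ω k.le_succ).trans_lt hfin),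
              fun j hj => N.monotone_time ω (Nat.lt_succ_iff.1 hj)⟩
        obtain ⟨c, hc, hcj⟩ := hc
        obtain ⟨z, hz0, hz1, hz2⟩ := ENNReal.lt_iff_exists_rat_btwn.1 hc
        have hz2' : ENNReal.ofReal z < N.time k ω := hz2
        refine ⟨z, ⟨?_, Or.inr ⟨z, rfl⟩⟩, fun j hj => (hcj j hj).trans hz1.le, hz2'⟩
        by_contra! h
        exact absurd (h1.trans (ENNReal.ofReal_le_ofReal h.le)) (not_le.2 hz2')
      have hb : ∃ b ∈ D, N.time k ω ≤ ENNReal.ofReal b ∧ ENNReal.ofReal b < N.time (k + 1) ω := by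
        have hlt := N.time_lt_of_lt k.lt_succ_self hfin
        by_cases h : ENNReal.ofReal q < N.time (k + 1) ω
        · exact ⟨q, ⟨le_rfl, Or.inl rfl⟩, h1, h⟩
        · obtain ⟨z, hz0, hz1, hz2⟩ := ENNReal.lt_iff_exists_rat_btwn.1 hlt
          have hz2' : ENNReal.ofReal z < N.time (k + 1) ω := hz2
          refine ⟨z, ⟨?_, Or.inr ⟨z, rfl⟩⟩, hz1.le, hz2'⟩
          have := hz2'.trans_le (not_lt.1 h)
          exact ((ENNReal.ofReal_lt_ofReal_iff hq).1 this).le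
      obtain ⟨a, haD, ha1, ha2⟩ := ha
      obtain ⟨b, hbD, hb1, hb2⟩ := hb
      exact ⟨a, haD, b, hbD, ⟨⟨⟨⟨ha1, ha2⟩, hb1⟩, hb2⟩, (hinc a b ha1 ha2 hb1 hb2).2 h2⟩⟩
    · rintro ⟨a, haD, b, hbD, ⟨⟨⟨⟨ha1, ha2⟩, hb1⟩, hb2⟩, h⟩⟩
      exact ⟨hb1.trans (ENNReal.ofReal_le_ofReal hbD.1), (hinc a b ha1 ha2 hb1 hb2).1 h⟩
  rw [hset]
  refine MeasurableSet.biUnion hD fun a ha => MeasurableSet.biUnion hD fun b hb => ?_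
  refine ((((Finset.measurableSet_biInter _ fun j _ => ?_).inter ?_).inter ?_).inter ?_).inter ?_
  · exact N.measurableSet_time_le_history j ha.1
  · exact (N.measurableSet_time_le_history k ha.1).compl
  · exact N.measurableSet_time_le_history k hb.1
  · exact (N.measurableSet_time_le_history (k + 1) hb.1).compl
  · exact measurableSet_eq_fun (N.measurable_count_history i hb.1 hK)
      ((N.measurable_count_history i ha.1 hK).add measurable_const)

lemma measurable_ite_of_measurableSet_inter {α β : Type*} {m : MeasurableSpace α}
    [MeasurableSpace β] {E : Set α} [DecidablePred (· ∈ E)] (hE : MeasurableSet E) {f : α → β}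
    (hf : ∀ D, MeasurableSet D → MeasurableSet {x | x ∈ E ∧ f x ∈ D}) (c : β) :
    Measurable fun x => if x ∈ E then f x else c := by
  intro D hD
  have : (fun x => if x ∈ E then f x else c) ⁻¹' D = {x | x ∈ E ∧ f x ∈ D} ∪ (Eᶜ ∩ {_x | c ∈ D}) := by
    ext x
    by_cases hx : x ∈ E <;> simp [hx]
  rw [this]
  exact (hf D hD).union (hE.compl.inter (MeasurableSet.const _))

/-- The events up to time `q` belong to the history at time `q`. -/
lemma measurableSet_point_history (k : ℕ) (q : ℝ) {D : Set (ℝ × Fin 2 × ℝ)}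
    (hD : MeasurableSet D) :
    MeasurableSet[N.history q] {ω | N.time k ω ≤ ENNReal.ofReal q ∧ N.point k ω ∈ D} := by
  classical
  let E : Set Ω := {ω | N.time k ω ≤ ENNReal.ofReal q}
  have hE : MeasurableSet[N.history q] E := N.measurableSet_time_le_history k le_rfl
  have h1 : Measurable[N.history q] fun ω => if ω ∈ E then (N.time k ω).toReal else 0 := by
    refine measurable_of_Iic fun c => ?_
    rcases lt_or_ge c 0 with hc | hc
    · convert @MeasurableSet.empty _ (N.history q)
      ext ω
      simp only [Set.mem_preimage, Set.mem_Iic, Set.mem_empty_iff_false, iff_false, not_le]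
      split_ifs
      · exact hc.trans_le ENNReal.toReal_nonneg
      · exact hc
    · have : (fun ω => if ω ∈ E then (N.time k ω).toReal else 0) ⁻¹' Set.Iic c
          = {ω | N.time k ω ≤ ENNReal.ofReal (min c q)} ∪ Eᶜ := by
        ext ω
        simp only [Set.mem_preimage, Set.mem_Iic, Set.mem_union, Set.mem_compl_iff,
          Set.mem_ofPred_eq, ENNReal.ofReal_min, le_min_iff]
        by_cases hω : ω ∈ E
        · have hω' : N.time k ω ≤ ENNReal.ofReal q := hω
          simp only [hω, if_true, not_true, or_false, hω', and_true]
          exact (ENNReal.le_ofReal_iff_toReal_le (hω'.trans_lt ENNReal.ofReal_lt_top).ne hc).symm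
        · simp [hω, hc]
      rw [this]
      exact (N.measurableSet_time_le_history k (min_le_right _ _)).union hE.compl
  have h2 : Measurable[N.history q] fun ω => if ω ∈ E then N.side k ω else 0 := by
    refine @measurable_to_countable' _ _ _ _ (N.history q) _ fun i => ?_
    have : (fun ω => if ω ∈ E then N.side k ω else 0) ⁻¹' {i}
        = {ω | N.time k ω ≤ ENNReal.ofReal q ∧ N.side k ω = i ∧ N.mark k ω ∈ Set.univ} ∪
          (Eᶜ ∩ {_ω | 0 = i}) := by
      ext ω
      by_cases hω : ω ∈ E
      · have hω' : N.time k ω ≤ ENNReal.ofReal q := hω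
        simp [hω, hω']
      · have hω' : ¬ N.time k ω ≤ ENNReal.ofReal q := hω
        simp [hω, hω']
    rw [this]
    exact (N.measurableSet_side_mark_history k q i .univ).union
      (hE.compl.inter (MeasurableSet.const _))
  have h3 : Measurable[N.history q] fun ω => if ω ∈ E then N.mark k ω else 0 := by
    refine measurable_ite_of_measurableSet_inter hE (fun K hK => ?_) 0
    have : {ω | ω ∈ E ∧ N.mark k ω ∈ K}
        = ⋃ i, {ω | N.time k ω ≤ ENNReal.ofReal q ∧ N.side k ω = i ∧ N.mark k ω ∈ K} := by
      ext ω
      simp [E]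
    rw [this]
    exact MeasurableSet.iUnion fun i => N.measurableSet_side_mark_history k q i hK
  have h4 := h1.prodMk (h2.prodMk h3)
  convert hE.inter (h4 hD) using 1
  ext ω
  refine and_congr_right fun hω => ?_
  have hω' : ω ∈ E := hω
  simp [point, hω']

end MarkedPointProcess

/-! ### Predictable sets and the compensator formula -/

namespace MarkedPointProcess

variable {Ω : Type*} [MeasurableSpace Ω] (N : MarkedPointProcess Ω)

/-- The rectangles `A × (s, t]` with `0 ≤ s ≤ t ≤ T` and `A` in the history at time `s`. -/
def predictableRectangles (T : ℝ) : Set (Set (Ω × ℝ)) :=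
  {S | ∃ (A : Set Ω) (s t : ℝ), 0 ≤ s ∧ s ≤ t ∧ t ≤ T ∧ MeasurableSet[N.history s] A ∧
    S = A ×ˢ Set.Ioc s t}

/-- The predictable `σ`-algebra on `Ω × (0, T]`, as a `σ`-algebra on `Ω × ℝ` for which the
complement of `Ω × (0, T]` is an atom. -/
abbrev predictable (T : ℝ) : MeasurableSpace (Ω × ℝ) :=
  MeasurableSpace.generateFrom (N.predictableRectangles T)

lemma history_mono : Monotone N.history := by
  intro q q' h
  refine iSup_le fun i => iSup_le fun r => iSup_le fun hr => iSup_le fun K => iSup_le fun hK => ?_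
  exact measurable_iff_comap_le.1 (N.measurable_count_history i (hr.trans h) hK)

lemma isPiSystem_predictableRectangles (T : ℝ) : IsPiSystem (N.predictableRectangles T) := by
  rintro _ ⟨A, s, t, hs, hst, ht, hA, rfl⟩ _ ⟨A', s', t', hs', hst', ht', hA', rfl⟩ hne
  rw [Set.prod_inter_prod, Set.Ioc_inter_Ioc] at hne ⊢
  have hlt : max s s' < min t t' := Set.nonempty_Ioc.1 (Set.prod_nonempty_iff.1 hne).2
  exact ⟨A ∩ A', max s s', min t t', le_max_of_le_left hs, hlt.le, min_le_of_left_le ht,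
    (N.history_mono (le_max_left _ _) _ hA).inter (N.history_mono (le_max_right _ _) _ hA'), rfl⟩

lemma predictable_le (T : ℝ) : N.predictable T ≤ Prod.instMeasurableSpace := by
  refine MeasurableSpace.generateFrom_le ?_
  rintro _ ⟨A, s, t, -, -, -, hA, rfl⟩
  exact (N.history_le s _ hA).prod measurableSet_Ioc

lemma measurableSet_predictable_prod {T : ℝ} {A : Set Ω} {s : ℝ} (hs : 0 ≤ s) (hsT : s ≤ T)
    (hA : MeasurableSet[N.history s] A) :
    MeasurableSet[N.predictable T] (A ×ˢ Set.Ioc s T) :=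
  MeasurableSpace.measurableSet_generateFrom ⟨A, s, T, hs, hsT, le_rfl, hA, rfl⟩

/-- Events that happened strictly before the present time are predictable. -/
lemma measurableSet_predictable_point {T : ℝ} (k : ℕ) {D : Set (ℝ × Fin 2 × ℝ)}
    (hD : MeasurableSet D) :
    MeasurableSet[N.predictable T] {z : Ω × ℝ | z.2 ∈ Set.Ioc 0 T ∧
      N.time k z.1 < ENNReal.ofReal z.2 ∧ N.point k z.1 ∈ D} := by
  have : {z : Ω × ℝ | z.2 ∈ Set.Ioc 0 T ∧ N.time k z.1 < ENNReal.ofReal z.2 ∧ N.point k z.1 ∈ D}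
      = ⋃ q : ℚ, ⋃ (_ : 0 ≤ (q : ℝ) ∧ (q : ℝ) ≤ T),
          {ω | N.time k ω ≤ ENNReal.ofReal q ∧ N.point k ω ∈ D} ×ˢ Set.Ioc (q : ℝ) T := by
    ext ⟨ω, u⟩
    simp only [Set.mem_ofPred_eq, Set.mem_iUnion, Set.mem_prod, Set.mem_Ioc, exists_prop]
    constructor
    · rintro ⟨⟨hu0, huT⟩, hlt, hp⟩
      obtain ⟨q, hq0, hq1, hq2⟩ := ENNReal.lt_iff_exists_rat_btwn.1 hlt
      have hq2' : ENNReal.ofReal q < ENNReal.ofReal u := hq2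
      have hq3 := (ENNReal.ofReal_lt_ofReal_iff hu0).1 hq2'
      exact ⟨q, ⟨by exact_mod_cast hq0, hq3.le.trans huT⟩, ⟨hq1.le, hp⟩, hq3, huT⟩
    · rintro ⟨q, ⟨hq0, hqT⟩, ⟨hle, hp⟩, hqu, huT⟩
      exact ⟨⟨hq0.trans_lt hqu, huT⟩,
        hle.trans_lt ((ENNReal.ofReal_lt_ofReal_iff (hq0.trans_lt hqu)).2 hqu), hp⟩
  rw [this]
  exact MeasurableSet.iUnion fun q => MeasurableSet.iUnion fun hq =>
    N.measurableSet_predictable_prod hq.1 hq.2 (N.measurableSet_point_history k q hD)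

/-- The part of `Ω × (0, T]` in which exactly the first `n` events are strictly before the present
time. -/
def window (n : ℕ) (T : ℝ) : Set (Ω × ℝ) :=
  {z | z.2 ∈ Set.Ioc 0 T ∧ (∀ k < n, N.time k z.1 < ENNReal.ofReal z.2) ∧
    ENNReal.ofReal z.2 ≤ N.time n z.1}

lemma measurableSet_predictable_Ioc {T : ℝ} {s : ℝ} (hs : 0 ≤ s) :
    MeasurableSet[N.predictable T] {z : Ω × ℝ | z.2 ∈ Set.Ioc s T} := by
  rcases le_total s T with h | h
  · have := N.measurableSet_predictable_prod hs h (@MeasurableSet.univ _ (N.history s))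
    rwa [Set.univ_prod] at this
  · rw [Set.Ioc_eq_empty (not_lt.2 h)]
    exact @MeasurableSet.empty _ (N.predictable T)

lemma measurableSet_predictable_window (n : ℕ) (T : ℝ) :
    MeasurableSet[N.predictable T] (N.window n T) := by
  have hlt : ∀ k, MeasurableSet[N.predictable T] {z : Ω × ℝ | z.2 ∈ Set.Ioc 0 T ∧
      N.time k z.1 < ENNReal.ofReal z.2} := fun k => by
    have := N.measurableSet_predictable_point (T := T) k (MeasurableSet.univ)
    simpa using this
  have : N.window n T = ({z : Ω × ℝ | z.2 ∈ Set.Ioc 0 T} ∩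
      ⋂ k ∈ Finset.range n, {z : Ω × ℝ | z.2 ∈ Set.Ioc 0 T ∧
        N.time k z.1 < ENNReal.ofReal z.2}) \ {z : Ω × ℝ | z.2 ∈ Set.Ioc 0 T ∧
        N.time n z.1 < ENNReal.ofReal z.2} := by
    ext z
    simp only [window, Set.mem_ofPred_eq, Set.mem_sdiff, Set.mem_inter_iff, Set.mem_iInter,
      Finset.mem_range, not_and, not_lt]
    constructor
    · rintro ⟨h1, h2, h3⟩
      exact ⟨⟨h1, fun k hk => ⟨h1, h2 k hk⟩⟩, fun _ => h3⟩
    · rintro ⟨⟨h1, h2⟩, h3⟩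
      exact ⟨h1, fun k hk => (h2 k hk).2, h3 h1⟩
  rw [this]
  exact ((N.measurableSet_predictable_Ioc le_rfl).inter
    (Finset.measurableSet_biInter _ fun k _ => hlt k)).diff (hlt n)

/-- On the window after the first `n` events, functions of the time and of these events are
predictable. -/
lemma measurable_predictable_indicator_window (n : ℕ) (T : ℝ)
    {ψ : (Fin n → ℝ × Fin 2 × ℝ) × ℝ → ℝ≥0∞} (hψ : Measurable ψ) :
    Measurable[N.predictable T]
      ((N.window n T).indicator fun z => ψ (firstPoints N.point n z.1, z.2)) := by
  classical
  let E : ℕ → Set (Ω × ℝ) := fun k =>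
    {z : Ω × ℝ | z.2 ∈ Set.Ioc 0 T ∧ N.time k z.1 < ENNReal.ofReal z.2}
  have hE : ∀ k, MeasurableSet[N.predictable T] (E k) := fun k => by
    have := N.measurableSet_predictable_point (T := T) k (MeasurableSet.univ)
    simpa [E] using this
  have h1 : ∀ k, Measurable[N.predictable T] fun z : Ω × ℝ =>
      if z ∈ E k then N.point k z.1 else 0 := by
    intro k
    refine measurable_ite_of_measurableSet_inter (hE k) (fun D hD => ?_) 0
    simpa only [E, Set.mem_ofPred_eq, and_assoc] using N.measurableSet_predictable_point k hD
  have h2 : Measurable[N.predictable T] fun z : Ω × ℝ => if z.2 ∈ Set.Ioc 0 T then z.2 else 0 := by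
    refine measurable_of_Ioi fun c => ?_
    rcases lt_or_ge c 0 with hc | hc
    · convert @MeasurableSet.univ _ (N.predictable T)
      rw [Set.eq_univ_iff_forall]
      intro z
      simp only [Set.mem_preimage, Set.mem_Ioi]
      split_ifs with h
      · exact hc.trans h.1
      · exact hc
    · convert N.measurableSet_predictable_Ioc hc using 1
      ext z
      simp only [Set.mem_preimage, Set.mem_Ioi, Set.mem_ofPred_eq, Set.mem_Ioc]
      split_ifs with h
      · simp [h.2]
      · constructor
        · exact fun h' => absurd h' (not_lt.2 hc)
        · exact fun h' => absurd ⟨hc.trans_lt h'.1, h'.2⟩ h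
  have h3 : Measurable[N.predictable T] fun z : Ω × ℝ =>
      ψ ((fun k : Fin n => if z ∈ E k then N.point k z.1 else 0),
        if z.2 ∈ Set.Ioc 0 T then z.2 else 0) :=
    hψ.comp (Measurable.prodMk (@measurable_pi_lambda _ _ _ (N.predictable T) _ _ fun k => h1 k) h2)
  have h4 := Measurable.indicator h3
    (N.measurableSet_predictable_window n T)
  convert h4 using 1
  ext z
  by_cases hz : z ∈ N.window n T
  · rw [Set.indicator_of_mem hz, Set.indicator_of_mem hz, if_pos hz.1]
    congr 2
    ext1 k
    rw [if_pos (show z ∈ E k from ⟨hz.1, hz.2.1 k k.2⟩)]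
    rfl
  · rw [Set.indicator_of_notMem hz, Set.indicator_of_notMem hz]

end MarkedPointProcess

namespace HawkesParams

variable {Ω : Type*} [MeasurableSpace Ω] (p : HawkesParams) (N : MarkedPointProcess Ω)

lemma measurable_impact : Measurable fun z : Fin 2 × ℝ => p.impact z.1 z.2 := by
  refine measurable_from_prod_countable_right fun j => ?_
  have h : Measurable fun v : ℝ => v ^ p.η j := by fun_prop
  exact h.div_const (∫ x, x ^ p.η j ∂(expMeasure (p.rate j)))

/-- The contribution of an event `x` to the intensity of coordinate `i` at a later time `u`. -/
def excitation (i : Fin 2) (x : ℝ × Fin 2 × ℝ) (u : ℝ) : ℝ :=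
  p.α i x.2.1 * Real.exp (-p.β i x.2.1 * (u - x.1)) * p.impact x.2.1 x.2.2

lemma measurable_excitation (i : Fin 2) :
    Measurable fun z : (ℝ × Fin 2 × ℝ) × ℝ => p.excitation i z.1 z.2 := by
  have h1 : Measurable (p.α i) := measurable_of_finite _
  have h2 : Measurable (p.β i) := measurable_of_finite _
  have h3 : Measurable fun z : (ℝ × Fin 2 × ℝ) × ℝ => p.impact z.1.2.1 z.1.2.2 :=
    p.measurable_impact.comp measurable_fst.snd
  unfold excitation
  fun_prop

open Classical in
lemma groundIntensity_eq (i : Fin 2) (u : ℝ) (ω : Ω) :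
    p.groundIntensity N i u ω = ENNReal.ofReal (p.μ i u) + ∑' k,
      if N.time k ω < ENNReal.ofReal u then ENNReal.ofReal (p.excitation i (N.point k ω) u) else 0 :=
  rfl

lemma measurable_groundIntensity (i : Fin 2) :
    Measurable fun z : Ω × ℝ => p.groundIntensity N i z.2 z.1 := by
  classical
  simp_rw [groundIntensity_eq]
  refine ((p.measurable_μ i).comp measurable_snd).ennreal_ofReal.add (Measurable.tsum fun k => ?_)
  refine Measurable.ite (measurableSet_lt ((N.measurable_time k).comp measurable_fst)
    measurable_snd.ennreal_ofReal) ?_ measurable_const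
  exact ((p.measurable_excitation i).comp
    (((N.measurable_point k).comp measurable_fst).prodMk measurable_snd)).ennreal_ofReal

/-- The law of the marks of coordinate `i`. -/
def markLaw (i : Fin 2) (K : Set ℝ) : ℝ≥0∞ := ∫⁻ v in K, exponentialPDF (p.rate i) v

lemma markLaw_univ (i : Fin 2) : p.markLaw i Set.univ = 1 := by
  rw [markLaw, Measure.restrict_univ, lintegral_exponentialPDF_eq_one (p.rate_pos i)]

lemma markLaw_ne_top (i : Fin 2) (K : Set ℝ) : p.markLaw i K ≠ ∞ := by
  refine ne_top_of_le_ne_top ENNReal.one_ne_top ?_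
  rw [← p.markLaw_univ i]
  exact lintegral_mono_set (Set.subset_univ K)

lemma compensator_eq (i : Fin 2) (s t : ℝ) (K : Set ℝ) (ω : Ω) :
    p.compensator N i s t K ω
      = ∫⁻ u in Set.Ioc s t, p.groundIntensity N i u ω * p.markLaw i K := by
  unfold compensator intensity
  refine lintegral_congr fun u => ?_
  rw [lintegral_const_mul _ (measurable_exponentialPDF' _), markLaw]

end HawkesParams

namespace HawkesParams.IsMarkedHawkes

variable {Ω : Type*} [MeasurableSpace Ω] {p : HawkesParams} {N : MarkedPointProcess Ω}
  {P : Measure Ω} [IsProbabilityMeasure P] {T : ℝ}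

/-- The sum over the events of a predictable function integrates to the integral of this function
with respect to the compensator. -/
theorem lintegral_predictable (hN : p.IsMarkedHawkes N P T) (hT : 0 ≤ T) (i : Fin 2) {K : Set ℝ}
    (hK : MeasurableSet K) {Z : Ω × ℝ → ℝ≥0∞} (hZ : Measurable[N.predictable T] Z) :
    ∑' k, ∫⁻ ω in {ω | N.time k ω ≤ ENNReal.ofReal T ∧ N.side k ω = i ∧ N.mark k ω ∈ K},
        Z (ω, (N.time k ω).toReal) ∂P
      = ∫⁻ ω, (∫⁻ u in Set.Ioc 0 T, Z (ω, u) * (p.groundIntensity N i u ω * p.markLaw i K)) ∂P := by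
  classical
  have hle := N.predictable_le T
  have hZ' : Measurable Z := hZ.mono hle le_rfl
  let S : ℕ → Set Ω := fun k =>
    {ω | N.time k ω ≤ ENNReal.ofReal T ∧ N.side k ω = i ∧ N.mark k ω ∈ K}
  have hS : ∀ k, MeasurableSet (S k) := fun k =>
    (measurableSet_le (N.measurable_time k) measurable_const).inter
      ((N.measurable_side k (measurableSet_singleton i)).inter (N.measurable_mark k hK))
  have hg : ∀ k, Measurable fun ω => (ω, (N.time k ω).toReal) := fun k =>
    measurable_id.prodMk (N.measurable_time k).ennreal_toReal
  let m1 : Measure (Ω × ℝ) := Measure.sum fun k =>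
    (P.restrict (S k)).map fun ω => (ω, (N.time k ω).toReal)
  let d : Ω × ℝ → ℝ≥0∞ := fun z => p.groundIntensity N i z.2 z.1 * p.markLaw i K
  have hd : Measurable d := (p.measurable_groundIntensity N i).mul_const _
  let m2 : Measure (Ω × ℝ) := (P.prod (volume.restrict (Set.Ioc 0 T))).withDensity d
  -- the two measures agree on predictable rectangles, by the definition of the compensator
  have hrect : ∀ (A : Set Ω) (s t : ℝ), 0 ≤ s → s ≤ t → t ≤ T → MeasurableSet[N.history s] A →
      m1 (A ×ˢ Set.Ioc s t) = m2 (A ×ˢ Set.Ioc s t) := by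
    intro A s t hs hst htT hA
    have hA' : MeasurableSet A := N.history_le s _ hA
    have hAI : MeasurableSet (A ×ˢ Set.Ioc s t) := hA'.prod measurableSet_Ioc
    have h1 : m1 (A ×ˢ Set.Ioc s t) = ∫⁻ ω in A, N.count i s t K ω ∂P := by
      simp only [m1, MarkedPointProcess.count]
      rw [Measure.sum_apply _ hAI, lintegral_tsum]
      · refine tsum_congr fun k => ?_
        have hm : MeasurableSet {ω | ENNReal.ofReal s < N.time k ω ∧
            N.time k ω ≤ ENNReal.ofReal t ∧ N.side k ω = i ∧ N.mark k ω ∈ K} :=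
          (measurableSet_lt measurable_const (N.measurable_time k)).inter
            ((measurableSet_le (N.measurable_time k) measurable_const).inter
            ((N.measurable_side k (measurableSet_singleton i)).inter (N.measurable_mark k hK)))
        have h2 := lintegral_indicator_one (μ := P.restrict A) hm
        rw [Measure.map_apply (hg k) hAI, Measure.restrict_apply (hg k hAI)]
        rw [Measure.restrict_apply hm] at h2
        simp only [Set.indicator_apply, Set.mem_ofPred_eq, Pi.one_apply] at h2
        refine Eq.trans ?_ h2.symm
        congr 1
        ext ω
        simp only [Set.mem_inter_iff, Set.mem_preimage, Set.mem_prod, Set.mem_Ioc, S,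
          Set.mem_ofPred_eq]
        constructor
        · rintro ⟨⟨h1, h2, h3⟩, h4, h5, h6⟩
          have hfin : N.time k ω ≠ ∞ := (h4.trans_lt ENNReal.ofReal_lt_top).ne
          exact ⟨⟨(ENNReal.ofReal_lt_iff_lt_toReal hs hfin).2 h2,
            (ENNReal.le_ofReal_iff_toReal_le hfin (hs.trans hst)).2 h3, h5, h6⟩, h1⟩
        · rintro ⟨⟨h2, h3, h5, h6⟩, h1⟩
          have hfin : N.time k ω ≠ ∞ := (h3.trans_lt ENNReal.ofReal_lt_top).ne
          exact ⟨⟨h1, (ENNReal.ofReal_lt_iff_lt_toReal hs hfin).1 h2,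
            (ENNReal.le_ofReal_iff_toReal_le hfin (hs.trans hst)).1 h3⟩,
            h3.trans (ENNReal.ofReal_le_ofReal htT), h5, h6⟩
      · intro k
        refine (Measurable.ite ?_ measurable_const measurable_const).aemeasurable
        exact (measurableSet_lt measurable_const (N.measurable_time k)).inter
          ((measurableSet_le (N.measurable_time k) measurable_const).inter
          ((N.measurable_side k (measurableSet_singleton i)).inter (N.measurable_mark k hK)))
    have h2 : m2 (A ×ˢ Set.Ioc s t) = ∫⁻ ω in A, p.compensator N i s t K ω ∂P := by
      simp only [m2]
      rw [withDensity_apply _ hAI, ← Measure.prod_restrict, Measure.restrict_restrict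
        measurableSet_Ioc, Set.Ioc_inter_Ioc, max_eq_left hs, min_eq_left htT,
        lintegral_prod _ hd.aemeasurable]
      simp_rw [compensator_eq]
      rfl
    rw [h1, h2, ← setLIntegral_condLExp (N.history_le s) P _ hA,
      ← setLIntegral_condLExp (N.history_le s) P (p.compensator N i s t K) hA]
    exact lintegral_congr_ae (ae_restrict_of_ae (hN.condLExp_count i s t hs hst htT K hK))
  have huniv1 : m1 Set.univ = m1 (Set.univ ×ˢ Set.Ioc 0 T) := by
    simp only [m1]
    rw [Measure.sum_apply _ .univ, Measure.sum_apply _ (MeasurableSet.univ.prod measurableSet_Ioc)]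
    refine tsum_congr fun k => ?_
    rw [Measure.map_apply (hg k) .univ, Measure.map_apply (hg k)
      (MeasurableSet.univ.prod measurableSet_Ioc), Measure.restrict_apply' (hS k),
      Measure.restrict_apply' (hS k)]
    congr 1
    ext ω
    simp only [Set.preimage_univ, Set.mem_inter_iff, Set.mem_univ, true_and, Set.mem_preimage,
      Set.mem_prod, Set.mem_Ioc]
    refine ⟨fun h => ⟨⟨?_, ?_⟩, h⟩, fun h => h.2⟩
    · exact ENNReal.toReal_pos (N.time_pos k ω).ne' (h.1.trans_lt ENNReal.ofReal_lt_top).ne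
    · exact ENNReal.toReal_le_of_le_ofReal hT h.1
  have huniv2 : m2 Set.univ = m2 (Set.univ ×ˢ Set.Ioc 0 T) := by
    simp only [m2]
    rw [withDensity_apply _ .univ, withDensity_apply _ (MeasurableSet.univ.prod measurableSet_Ioc),
      ← Measure.prod_restrict, Measure.restrict_restrict measurableSet_Ioc, Set.inter_self,
      Measure.restrict_univ, Measure.restrict_univ]
  have huniv : m1 Set.univ = m2 Set.univ := by
    rw [huniv1, huniv2]
    exact hrect _ 0 T le_rfl hT le_rfl (@MeasurableSet.univ _ (N.history 0))
  have hfin : m1 Set.univ < ∞ := by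
    refine lt_of_le_of_lt ?_ (hN.lintegral_count_lt_top i)
    simp only [m1, MarkedPointProcess.count]
    rw [Measure.sum_apply _ .univ, lintegral_tsum]
    · refine ENNReal.tsum_le_tsum fun k => ?_
      rw [Measure.map_apply (hg k) .univ, Set.preimage_univ, Measure.restrict_apply_univ,
        ← lintegral_indicator_one (hS k)]
      refine lintegral_mono fun ω => ?_
      by_cases hω : ω ∈ S k
      · rw [Set.indicator_of_mem hω, if_pos]
        · rfl
        · exact ⟨by simpa using N.time_pos k ω, hω.1, hω.2.1, Set.mem_univ _⟩
      · rw [Set.indicator_of_notMem hω]; exact zero_le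
    · intro k
      refine (Measurable.ite ?_ measurable_const measurable_const).aemeasurable
      exact (measurableSet_lt measurable_const (N.measurable_time k)).inter
        ((measurableSet_le (N.measurable_time k) measurable_const).inter
        ((N.measurable_side k (measurableSet_singleton i)).inter
          (N.measurable_mark k .univ)))
  have hfin' : IsFiniteMeasure (m1.trim hle) := by
    refine ⟨?_⟩
    rwa [trim_measurableSet_eq hle (@MeasurableSet.univ _ (N.predictable T))]
  have heq : m1.trim hle = m2.trim hle := by
    refine ext_of_generate_finite (N.predictableRectangles T) rfl
      (N.isPiSystem_predictableRectangles T) ?_ ?_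
    · rintro _ ⟨A, s, t, hs, hst, ht, hA, rfl⟩
      have hm : MeasurableSet[N.predictable T] (A ×ˢ Set.Ioc s t) :=
        MeasurableSpace.measurableSet_generateFrom ⟨A, s, t, hs, hst, ht, hA, rfl⟩
      rw [trim_measurableSet_eq hle hm, trim_measurableSet_eq hle hm]
      exact hrect A s t hs hst ht hA
    · rw [trim_measurableSet_eq hle (@MeasurableSet.univ _ (N.predictable T)),
        trim_measurableSet_eq hle (@MeasurableSet.univ _ (N.predictable T)), huniv]
  have h1 : ∫⁻ z, Z z ∂m1
      = ∑' k, ∫⁻ ω in S k, Z (ω, (N.time k ω).toReal) ∂P := by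
    simp only [m1]
    rw [lintegral_sum_measure]
    exact tsum_congr fun k => lintegral_map hZ' (hg k)
  have h2 : ∫⁻ z, Z z ∂m2 = ∫⁻ ω, (∫⁻ u in Set.Ioc 0 T, Z (ω, u) * d (ω, u)) ∂P := by
    simp only [m2]
    rw [lintegral_withDensity_eq_lintegral_mul _ hd hZ', lintegral_prod _ (hd.mul hZ').aemeasurable]
    refine lintegral_congr fun ω => lintegral_congr fun u => ?_
    rw [Pi.mul_apply, mul_comm]
  refine h1.symm.trans (Eq.trans ?_ h2)
  rw [← lintegral_trim hle hZ, ← lintegral_trim hle hZ, heq]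

end HawkesParams.IsMarkedHawkes

/-! ### The law of the next event given the events before -/

lemma measurable_comp₂ {α X Y Z : Type*} [MeasurableSpace α] [MeasurableSpace X]
    [MeasurableSpace Y] [MeasurableSpace Z] {f : X → Y → Z}
    (hf : Measurable fun z : X × Y => f z.1 z.2) {g : α → X} {h : α → Y} (hg : Measurable g)
    (hh : Measurable h) : Measurable fun a => f (g a) (h a) :=
  hf.comp (hg.prodMk hh)

namespace HawkesParams

variable (p : HawkesParams)

open Classical in
/-- The intensity of coordinate `i` at time `u`, as a function of the `n` events `x` that precede
`u`; it is set to `0` unless all of these events are strictly before `u`. -/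
def hazard (i : Fin 2) (n : ℕ) (x : Fin n → ℝ × Fin 2 × ℝ) (u : ℝ) : ℝ≥0∞ :=
  if ∀ k, (x k).1 < u then
    ENNReal.ofReal (p.μ i u) + ∑ k, ENNReal.ofReal (p.excitation i (x k) u) else 0

/-- The total intensity of both coordinates after the events `x`. -/
def totalHazard (n : ℕ) (x : Fin n → ℝ × Fin 2 × ℝ) (u : ℝ) : ℝ≥0∞ := ∑ i, p.hazard i n x u

/-- The total intensity after the events `x`, integrated up to time `t`. -/
def cumHazard (n : ℕ) (x : Fin n → ℝ × Fin 2 × ℝ) (t : ℝ) : ℝ≥0∞ :=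
  ∫⁻ u in Set.Ioc 0 t, p.totalHazard n x u

/-- The conditional probability, given the events `x`, that there is no further event by `t`. -/
def survival (n : ℕ) (x : Fin n → ℝ × Fin 2 × ℝ) (t : ℝ) : ℝ≥0∞ :=
  ENNReal.ofReal (Real.exp (-(p.cumHazard n x t).toReal))

lemma measurable_hazard (i : Fin 2) (n : ℕ) :
    Measurable fun z : (Fin n → ℝ × Fin 2 × ℝ) × ℝ => p.hazard i n z.1 z.2 := by
  classical
  unfold hazard
  refine Measurable.ite ?_ ?_ measurable_const
  · have : {z : (Fin n → ℝ × Fin 2 × ℝ) × ℝ | ∀ k, (z.1 k).1 < z.2} = ⋂ k, {z | (z.1 k).1 < z.2} := by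
      ext; simp
    rw [this]
    exact MeasurableSet.iInter fun k => measurableSet_lt (by fun_prop) measurable_snd
  · refine ((p.measurable_μ i).comp measurable_snd).ennreal_ofReal.add
      (Finset.measurable_sum _ fun k _ => Measurable.ennreal_ofReal ?_)
    have h : Measurable fun z : (Fin n → ℝ × Fin 2 × ℝ) × ℝ => (z.1 k, z.2) := by fun_prop
    exact (p.measurable_excitation i).comp h

lemma measurable_totalHazard (n : ℕ) :
    Measurable fun z : (Fin n → ℝ × Fin 2 × ℝ) × ℝ => p.totalHazard n z.1 z.2 :=
  Finset.measurable_sum _ fun i _ => p.measurable_hazard i n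

lemma measurable_cumHazard (n : ℕ) :
    Measurable fun z : (Fin n → ℝ × Fin 2 × ℝ) × ℝ => p.cumHazard n z.1 z.2 := by
  have h : ∀ z : (Fin n → ℝ × Fin 2 × ℝ) × ℝ, p.cumHazard n z.1 z.2
      = ∫⁻ u, {w : ((Fin n → ℝ × Fin 2 × ℝ) × ℝ) × ℝ | 0 < w.2 ∧ w.2 ≤ w.1.2}.indicator
          (fun w => p.totalHazard n w.1.1 w.2) (z, u) := by
    intro z
    rw [cumHazard, ← lintegral_indicator measurableSet_Ioc]
    rfl
  simp_rw [h]
  refine Measurable.lintegral_prod_right' (Measurable.indicator ?_ ?_)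
  · exact (p.measurable_totalHazard n).comp (measurable_fst.fst.prodMk measurable_snd)
  · exact (measurableSet_lt measurable_const measurable_snd).inter
      (measurableSet_le measurable_snd measurable_fst.snd)

lemma measurable_survival (n : ℕ) :
    Measurable fun z : (Fin n → ℝ × Fin 2 × ℝ) × ℝ => p.survival n z.1 z.2 := by
  have := p.measurable_cumHazard n
  exact this.ennreal_toReal.neg.exp.ennreal_ofReal

lemma cumHazard_mono (n : ℕ) (x : Fin n → ℝ × Fin 2 × ℝ) : Monotone (p.cumHazard n x) :=
  fun _ _ h => lintegral_mono_set (Set.Ioc_subset_Ioc_right h)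

lemma excitation_le (i : Fin 2) (x : ℝ × Fin 2 × ℝ) {u : ℝ} (h : x.1 ≤ u) :
    p.excitation i x u ≤ p.α i x.2.1 * |p.impact x.2.1 x.2.2| := by
  have h1 := p.α_nonneg i x.2.1
  have h2 : Real.exp (-p.β i x.2.1 * (u - x.1)) ≤ 1 := by
    rw [Real.exp_le_one_iff]
    have := mul_nonneg (p.β_pos i x.2.1).le (sub_nonneg.2 h)
    linarith
  calc p.excitation i x u
      ≤ p.α i x.2.1 * Real.exp (-p.β i x.2.1 * (u - x.1)) * |p.impact x.2.1 x.2.2| :=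
        mul_le_mul_of_nonneg_left (le_abs_self _) (mul_nonneg h1 (Real.exp_pos _).le)
    _ ≤ p.α i x.2.1 * 1 * |p.impact x.2.1 x.2.2| := by gcongr
    _ = _ := by rw [mul_one]

lemma cumHazard_ne_top {T : ℝ} (hμ : ∀ i, ∫⁻ u in Set.Ioc 0 T, ENNReal.ofReal (p.μ i u) ≠ ∞)
    (n : ℕ) (x : Fin n → ℝ × Fin 2 × ℝ) {t : ℝ} (ht : t ≤ T) : p.cumHazard n x t ≠ ∞ := by
  refine ne_top_of_le_ne_top ?_ (p.cumHazard_mono n x ht)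
  have hle : ∀ u, p.totalHazard n x u ≤ ∑ i, (ENNReal.ofReal (p.μ i u) +
      ∑ k, ENNReal.ofReal (p.α i (x k).2.1 * |p.impact (x k).2.1 (x k).2.2|)) := by
    intro u
    refine Finset.sum_le_sum fun i _ => ?_
    unfold hazard
    split_ifs with h
    · gcongr with k _
      exact p.excitation_le i (x k) (h k).le
    · exact zero_le
  refine ne_top_of_le_ne_top ?_ (lintegral_mono hle)
  have hm : ∀ i, Measurable fun u => ENNReal.ofReal (p.μ i u) := fun i =>
    (p.measurable_μ i).ennreal_ofReal
  rw [lintegral_finsetSum _ fun i _ => (hm i).add_const _]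
  refine ENNReal.sum_ne_top.2 fun i _ => ?_
  rw [lintegral_add_right _ measurable_const, setLIntegral_const]
  refine ENNReal.add_ne_top.2 ⟨hμ i, ENNReal.mul_ne_top ?_ ?_⟩
  · exact ENNReal.sum_ne_top.2 fun k _ => ENNReal.ofReal_ne_top
  · simp

/-- The weight `exp (Λ(u) - Λ(t))` for the integrated hazard `Λ` after the events `x`. -/
def weight (n : ℕ) (t : ℝ) (z : (Fin n → ℝ × Fin 2 × ℝ) × ℝ) : ℝ≥0∞ :=
  ENNReal.ofReal (Real.exp (p.cumHazard n z.1 z.2).toReal) * p.survival n z.1 t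

lemma measurable_weight (n : ℕ) (t : ℝ) : Measurable (p.weight n t) := by
  have h1 := p.measurable_cumHazard n
  have h2 : Measurable fun z : (Fin n → ℝ × Fin 2 × ℝ) × ℝ => p.survival n z.1 t :=
    measurable_comp₂ (f := p.survival n) (p.measurable_survival n) measurable_fst measurable_const
  exact (h1.ennreal_toReal.exp.ennreal_ofReal).mul h2

lemma weight_le_one {n : ℕ} {x : Fin n → ℝ × Fin 2 × ℝ} {t u : ℝ} (ht : p.cumHazard n x t ≠ ∞)
    (hu : u ≤ t) : p.weight n t (x, u) ≤ 1 := by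
  simp only [weight, survival]
  rw [← ENNReal.ofReal_mul (Real.exp_pos _).le, ← Real.exp_add, ← ENNReal.ofReal_one]
  refine ENNReal.ofReal_le_ofReal (Real.exp_le_one_iff.2 ?_)
  have := ENNReal.toReal_mono ht (p.cumHazard_mono n x hu)
  linarith

lemma weight_self (n : ℕ) (t : ℝ) (x : Fin n → ℝ × Fin 2 × ℝ) : p.weight n t (x, t) = 1 := by
  simp only [weight, survival]
  rw [← ENNReal.ofReal_mul (Real.exp_pos _).le, ← Real.exp_add]
  simp

end HawkesParams

namespace HawkesParams.IsMarkedHawkes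

variable {Ω : Type*} [MeasurableSpace Ω] {p : HawkesParams} {N : MarkedPointProcess Ω}
  {P : Measure Ω} [IsProbabilityMeasure P] {T : ℝ}

/-- The baselines are integrable, as they are dominated by the intensities, whose integrals have the
same expectations as the numbers of events. -/
lemma lintegral_baseline_ne_top (hN : p.IsMarkedHawkes N P T) (hT : 0 ≤ T) (i : Fin 2) :
    ∫⁻ u in Set.Ioc 0 T, ENNReal.ofReal (p.μ i u) ≠ ∞ := by
  have h1 : ∫⁻ ω, p.compensator N i 0 T Set.univ ω ∂P < ∞ := by
    rw [← lintegral_condLExp (N.history_le 0) P,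
      ← lintegral_congr_ae (hN.condLExp_count i 0 T le_rfl hT le_rfl _ .univ),
      lintegral_condLExp (N.history_le 0) P]
    exact hN.lintegral_count_lt_top i
  refine ne_top_of_le_ne_top h1.ne ?_
  calc ∫⁻ u in Set.Ioc 0 T, ENNReal.ofReal (p.μ i u)
      = ∫⁻ _, (∫⁻ u in Set.Ioc 0 T, ENNReal.ofReal (p.μ i u)) ∂P := by simp
    _ ≤ ∫⁻ ω, p.compensator N i 0 T Set.univ ω ∂P := by
        refine lintegral_mono fun ω => ?_
        rw [compensator_eq]
        refine lintegral_mono fun u => ?_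
        rw [markLaw_univ, mul_one]
        exact le_self_add

/-- Between the `n`-th and the next event the intensity is the hazard of the first `n` events. -/
lemma indicator_window_mul (i : Fin 2) (n : ℕ) (ψ : ℝ → ℝ≥0∞) (ω : Ω) {u : ℝ}
    (hu : u ∈ Set.Ioc 0 T) [Decidable (ω ∈ reached N.time (ENNReal.ofReal T) n)]
    [Decidable (ENNReal.ofReal u ≤ N.time n ω)] :
    (N.window n T).indicator (fun z => ψ z.2) (ω, u) * p.groundIntensity N i u ω
      = if ω ∈ reached N.time (ENNReal.ofReal T) n then
          if ENNReal.ofReal u ≤ N.time n ω then ψ u * p.hazard i n (firstPoints N.point n ω) u else 0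
        else 0 := by
  classical
  by_cases hw : (ω, u) ∈ N.window n T
  · have hw' := hw
    obtain ⟨-, h2, h3⟩ := hw'
    dsimp only at h2 h3
    have hr : ω ∈ reached N.time (ENNReal.ofReal T) n := fun k hk =>
      (h2 k hk).le.trans (ENNReal.ofReal_le_ofReal hu.2)
    rw [Set.indicator_of_mem hw, if_pos hr, if_pos h3]
    congr 1
    have hlt : ∀ k, (firstPoints N.point n ω k).1 < u := fun k => by
      have := h2 k k.2
      exact (ENNReal.lt_ofReal_iff_toReal_lt (this.trans ENNReal.ofReal_lt_top).ne).1 this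
    rw [groundIntensity_eq, hazard, if_pos hlt, tsum_eq_sum (s := Finset.range n)]
    · congr 1
      rw [Finset.sum_range]
      refine Finset.sum_congr rfl fun k _ => ?_
      rw [if_pos (h2 k k.2)]
      rfl
    · intro k hk
      rw [if_neg]
      exact not_lt.2 (h3.trans (N.monotone_time ω (not_lt.1 (Finset.mem_range.not.1 hk))))
  · rw [Set.indicator_of_notMem hw, zero_mul]
    split_ifs with hr h3
    · rw [hazard, if_neg, mul_zero]
      intro h
      refine hw ⟨hu, fun k hk => ?_, h3⟩
      have hfin : N.time k ω ≠ ∞ := ((hr k hk).trans_lt ENNReal.ofReal_lt_top).ne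
      exact (ENNReal.lt_ofReal_iff_toReal_lt hfin).2 (h ⟨k, hk⟩)
    · rfl
    · rfl

open Classical in
/-- The compensator formula for the next event after the first `n` ones. -/
lemma lintegral_next_event (hN : p.IsMarkedHawkes N P T) (hT : 0 ≤ T) (n : ℕ) (i : Fin 2)
    {K : Set ℝ} (hK : MeasurableSet K) {ψ : (Fin n → ℝ × Fin 2 × ℝ) × ℝ → ℝ≥0∞}
    (hψ : Measurable ψ) :
    ∫⁻ ω in {ω | N.time n ω ≤ ENNReal.ofReal T ∧ N.side n ω = i ∧ N.mark n ω ∈ K},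
        ψ (firstPoints N.point n ω, (N.time n ω).toReal) ∂P
      = (∫⁻ ω in reached N.time (ENNReal.ofReal T) n, (∫⁻ u in Set.Ioc 0 T,
          if ENNReal.ofReal u ≤ N.time n ω then
            ψ (firstPoints N.point n ω, u) * p.hazard i n (firstPoints N.point n ω) u else 0) ∂P)
        * p.markLaw i K := by
  have hZ := N.measurable_predictable_indicator_window n T hψ
  have h := hN.lintegral_predictable hT i hK hZ
  have hS : ∀ k, MeasurableSet
      {ω | N.time k ω ≤ ENNReal.ofReal T ∧ N.side k ω = i ∧ N.mark k ω ∈ K} := fun k =>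
    (measurableSet_le (N.measurable_time k) measurable_const).inter
      ((N.measurable_side k (measurableSet_singleton i)).inter (N.measurable_mark k hK))
  rw [tsum_eq_single n] at h
  · have h1 : ∫⁻ ω in {ω | N.time n ω ≤ ENNReal.ofReal T ∧ N.side n ω = i ∧ N.mark n ω ∈ K},
        ψ (firstPoints N.point n ω, (N.time n ω).toReal) ∂P
      = ∫⁻ ω in {ω | N.time n ω ≤ ENNReal.ofReal T ∧ N.side n ω = i ∧ N.mark n ω ∈ K},
        (N.window n T).indicator (fun z => ψ (firstPoints N.point n z.1, z.2))
          (ω, (N.time n ω).toReal) ∂P := by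
      refine setLIntegral_congr_fun (hS n) fun ω hω => ?_
      have hfin : N.time n ω < ∞ := hω.1.trans_lt ENNReal.ofReal_lt_top
      rw [Set.indicator_of_mem]
      refine ⟨⟨ENNReal.toReal_pos (N.time_pos n ω).ne' hfin.ne,
        ENNReal.toReal_le_of_le_ofReal hT hω.1⟩, fun k hk => ?_, ?_⟩
      · rw [ENNReal.ofReal_toReal hfin.ne]
        exact N.time_lt_of_lt hk ((N.monotone_time ω hk.le).trans_lt hfin)
      · rw [ENNReal.ofReal_toReal hfin.ne]
    rw [h1, h, ← lintegral_indicator (measurableSet_reached N.measurable_time _ n),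
      ← lintegral_mul_const' _ _ (p.markLaw_ne_top i K)]
    refine lintegral_congr fun ω => ?_
    have h2 : ∀ u ∈ Set.Ioc 0 T, (N.window n T).indicator
          (fun z => ψ (firstPoints N.point n z.1, z.2)) (ω, u)
          * (p.groundIntensity N i u ω * p.markLaw i K)
        = (if ω ∈ reached N.time (ENNReal.ofReal T) n then
            if ENNReal.ofReal u ≤ N.time n ω then
              ψ (firstPoints N.point n ω, u) * p.hazard i n (firstPoints N.point n ω) u else 0
          else 0) * p.markLaw i K := by
      intro u hu
      rw [← mul_assoc, ← indicator_window_mul i n (fun u => ψ (firstPoints N.point n ω, u)) ω hu]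
      rfl
    rw [setLIntegral_congr_fun measurableSet_Ioc h2,
      lintegral_mul_const' _ _ (p.markLaw_ne_top i K)]
    by_cases hr : ω ∈ reached N.time (ENNReal.ofReal T) n <;> simp [hr]
  · -- at the other event times, the present is outside the window
    intro k hk
    rw [setLIntegral_congr_fun (hS k) (g := fun _ => 0), lintegral_zero]
    intro ω hω
    have hfin : N.time k ω < ∞ := hω.1.trans_lt ENNReal.ofReal_lt_top
    dsimp only
    rw [Set.indicator_of_notMem]
    rintro ⟨-, h2, h3⟩
    rw [ENNReal.ofReal_toReal hfin.ne] at h2 h3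
    rcases hk.lt_or_gt with h | h
    · exact lt_irrefl _ (h2 k h)
    · exact absurd (N.time_lt_of_lt h ((N.monotone_time ω h.le).trans_lt hfin)) (not_lt.2 h3)

/-- The integral of the weighted hazard up to `r` is the increment of the weight over `(0, r]`. For
this weight, the compensator formula for the next event therefore has on its right-hand side the
weight of the next event if that happens by `t`, and otherwise the weight `1` at time `t`, in both
cases minus the survival probability at `t`. -/
lemma lintegral_weighted_hazard (hN : p.IsMarkedHawkes N P T) (hT : 0 ≤ T) (n : ℕ)
    (x : Fin n → ℝ × Fin 2 × ℝ) {t r : ℝ} (hr : 0 ≤ r) (hrT : r ≤ T) :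
    (∫⁻ u in Set.Ioc 0 r, p.totalHazard n x u * p.weight n t (x, u))
      + p.survival n x t = p.weight n t (x, r) := by
  have hm : Measurable (p.totalHazard n x) := (p.measurable_totalHazard n).comp measurable_prodMk_left
  have h := lintegral_mul_exp_primitive hm hr
    (p.cumHazard_ne_top (hN.lintegral_baseline_ne_top hT) n x hrT)
  simp only [weight]
  simp_rw [← mul_assoc]
  rw [lintegral_mul_const' (p.survival n x t) _ ENNReal.ofReal_ne_top]
  nth_rewrite 2 [← one_mul (p.survival n x t)]
  rw [← add_mul]
  congr 1

open Classical in
/-- The conditional probability, given the first `n` events, that there is no further event by time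
`t` is the exponential of minus the integrated hazard. -/
theorem measure_survival (hN : p.IsMarkedHawkes N P T) (hT : 0 ≤ T) (n : ℕ) {t : ℝ} (ht : 0 ≤ t)
    (htT : t ≤ T) {B : Set (Fin n → ℝ × Fin 2 × ℝ)} (hB : MeasurableSet B) :
    P (reached N.time (ENNReal.ofReal T) n ∩ firstPoints N.point n ⁻¹' B ∩
        {ω | ENNReal.ofReal t < N.time n ω})
      = ∫⁻ ω in reached N.time (ENNReal.ofReal T) n ∩ firstPoints N.point n ⁻¹' B,
          p.survival n (firstPoints N.point n ω) t ∂P := by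
  set R := reached N.time (ENNReal.ofReal T) n with hR
  set H := firstPoints N.point n with hH
  have hRm : MeasurableSet R := measurableSet_reached N.measurable_time _ n
  have hHm : Measurable H := measurable_firstPoints N.measurable_point n
  have hBm : MeasurableSet (H ⁻¹' B) := hHm hB
  have hcum : ∀ x {s : ℝ}, s ≤ T → p.cumHazard n x s ≠ ∞ := fun x s hs =>
    p.cumHazard_ne_top (hN.lintegral_baseline_ne_top hT) n x hs
  have hw := p.measurable_weight n t
  let ψ : (Fin n → ℝ × Fin 2 × ℝ) × ℝ → ℝ≥0∞ := (B ×ˢ Set.Iic t).indicator (p.weight n t)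
  have hψ : Measurable ψ := hw.indicator (hB.prod measurableSet_Iic)
  have hEF : ∀ i, _ := fun i => hN.lintegral_next_event hT n i (K := Set.univ) .univ hψ
  simp only [markLaw_univ, mul_one, Set.mem_univ, and_true] at hEF
  have hsum := Finset.sum_congr (rfl : (Finset.univ : Finset (Fin 2)) = Finset.univ)
    fun i _ => hEF i
  -- the events by time `t`, of both coordinates
  let J : Ω → ℝ≥0∞ := fun ω => if N.time n ω ≤ ENNReal.ofReal t then
    p.weight n t (H ω, (N.time n ω).toReal)
    else 0
  have hJm : Measurable J := Measurable.ite (measurableSet_le (N.measurable_time n) measurable_const)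
    (measurable_comp₂ (f := fun x u => p.weight n t (x, u)) hw hHm
      (N.measurable_time n).ennreal_toReal) measurable_const
  have hlhs : ∑ i, ∫⁻ ω in {ω | N.time n ω ≤ ENNReal.ofReal T ∧ N.side n ω = i},
      ψ (H ω, (N.time n ω).toReal) ∂P = ∫⁻ ω in R ∩ H ⁻¹' B, J ω ∂P := by
    have hm : ∀ i, MeasurableSet {ω | N.time n ω ≤ ENNReal.ofReal T ∧ N.side n ω = i} := fun i =>
      (measurableSet_le (N.measurable_time n) measurable_const).inter
        (N.measurable_side n (measurableSet_singleton i))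
    simp_rw [← lintegral_indicator (hm _)]
    rw [← lintegral_indicator (hRm.inter hBm), ← lintegral_finsetSum]
    · refine lintegral_congr fun ω => ?_
      by_cases hle : N.time n ω ≤ ENNReal.ofReal T
      · have hωR : ω ∈ R := fun k hk => (N.monotone_time ω hk.le).trans hle
        have hfin : N.time n ω ≠ ∞ := (hle.trans_lt ENNReal.ofReal_lt_top).ne
        have hiff := ENNReal.le_ofReal_iff_toReal_le hfin ht
        simp only [Set.indicator_apply, Set.mem_ofPred_eq, hle, true_and, Finset.sum_ite_eq,
          Finset.mem_univ, if_true, ψ, Set.mem_inter_iff, hωR, Set.mem_preimage, Set.mem_prod,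
          Set.mem_Iic, J, hiff]
        by_cases h1 : H ω ∈ B <;> simp [h1]
      · have h2 : ¬ N.time n ω ≤ ENNReal.ofReal t := fun h =>
          hle (h.trans (ENNReal.ofReal_le_ofReal htT))
        simp [Set.indicator_apply, hle, J, h2]
    · intro i _
      exact (hψ.comp (hHm.prodMk (N.measurable_time n).ennreal_toReal)).indicator (hm i)
  let I : Ω → ℝ≥0∞ := fun ω => ∫⁻ u in Set.Ioc 0 T, if ENNReal.ofReal u ≤ N.time n ω then
    ψ (H ω, u) * p.totalHazard n (H ω) u else 0
  have hrhs : ∑ i, ∫⁻ ω in R, (∫⁻ u in Set.Ioc 0 T, if ENNReal.ofReal u ≤ N.time n ω then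
      ψ (H ω, u) * p.hazard i n (H ω) u else 0) ∂P = ∫⁻ ω in R, I ω ∂P := by
    have hm : ∀ i, Measurable fun z : Ω × ℝ => if ENNReal.ofReal z.2 ≤ N.time n z.1 then
        ψ (H z.1, z.2) * p.hazard i n (H z.1) z.2 else 0 := fun i => by
      refine Measurable.ite (measurableSet_le measurable_snd.ennreal_ofReal
        ((N.measurable_time n).comp measurable_fst)) ?_ measurable_const
      have : Measurable fun z : Ω × ℝ => (H z.1, z.2) :=
        (hHm.comp measurable_fst).prodMk measurable_snd
      exact (hψ.comp this).mul ((p.measurable_hazard i n).comp this)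
    have hm' : ∀ ω i, Measurable fun u => if ENNReal.ofReal u ≤ N.time n ω then
        ψ (H ω, u) * p.hazard i n (H ω) u else 0 := fun ω i => (hm i).comp measurable_prodMk_left
    rw [← lintegral_finsetSum _ fun i _ => (hm i).lintegral_prod_right']
    refine lintegral_congr fun ω => ?_
    dsimp only
    rw [← lintegral_finsetSum _ fun i _ => hm' ω i]
    refine lintegral_congr fun u => ?_
    simp only [totalHazard, Finset.mul_sum]
    split_ifs <;> simp
  have hI : ∀ ω, ω ∈ R → I ω = (H ⁻¹' B).indicator I ω := by
    intro ω _
    by_cases h : H ω ∈ B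
    · rw [Set.indicator_of_mem (show ω ∈ H ⁻¹' B from h)]
    · rw [Set.indicator_of_notMem (show ω ∉ H ⁻¹' B from h)]
      simp [I, ψ, h]
  have hkey : ∫⁻ ω in R ∩ H ⁻¹' B, J ω ∂P = ∫⁻ ω in R ∩ H ⁻¹' B, I ω ∂P := by
    rw [← hlhs, hsum, hrhs, setLIntegral_congr_fun hRm hI, setLIntegral_indicator hBm,
      Set.inter_comm]
  have hpt : ∀ ω ∈ R ∩ H ⁻¹' B, I ω + p.survival n (H ω) t
      = J ω + {ω | ENNReal.ofReal t < N.time n ω}.indicator 1 ω := by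
    rintro ω ⟨-, hωB⟩
    have hωB' : H ω ∈ B := hωB
    -- the hazard is integrated up to the next event or to `t`, whichever comes first
    have hIr : ∀ r, (∀ u ∈ Set.Ioc 0 T, (ENNReal.ofReal u ≤ N.time n ω ∧ u ≤ t ↔ u ≤ r)) → r ≤ T →
        I ω = ∫⁻ u in Set.Ioc 0 r, p.totalHazard n (H ω) u * p.weight n t (H ω, u) := by
      intro r hr hrT
      simp only [I]
      rw [← lintegral_indicator measurableSet_Ioc, ← lintegral_indicator measurableSet_Ioc]
      refine lintegral_congr fun u => ?_
      by_cases hu : u ∈ Set.Ioc 0 T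
      · rw [Set.indicator_of_mem hu]
        have := hr u hu
        by_cases hur : u ≤ r
        · rw [Set.indicator_of_mem (s := Set.Ioc 0 r) ⟨hu.1, hur⟩, if_pos (this.2 hur).1, mul_comm]
          simp [ψ, hωB', (this.2 hur).2]
        · rw [Set.indicator_of_notMem (s := Set.Ioc 0 r) fun h => hur h.2]
          split_ifs with h
          · have : ¬ u ≤ t := fun h' => hur (this.1 ⟨h, h'⟩)
            simp [ψ, this]
          · rfl
      · rw [Set.indicator_of_notMem hu, Set.indicator_of_notMem (s := Set.Ioc 0 r) fun h =>
          hu ⟨h.1, h.2.trans hrT⟩]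
    by_cases hlt : ENNReal.ofReal t < N.time n ω
    · rw [hIr t (fun u hu => ⟨fun h => h.2, fun h =>
        ⟨(ENNReal.ofReal_le_ofReal h).trans hlt.le, h⟩⟩) htT,
        hN.lintegral_weighted_hazard hT n (H ω) ht htT, Set.indicator_of_mem (by exact hlt)]
      have : J ω = 0 := if_neg (not_le.2 hlt)
      rw [this, zero_add]
      exact p.weight_self n t (H ω)
    · have hle : N.time n ω ≤ ENNReal.ofReal t := not_lt.1 hlt
      have hfin : N.time n ω ≠ ∞ := (hle.trans_lt ENNReal.ofReal_lt_top).ne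
      have hτ : (N.time n ω).toReal ≤ t := ENNReal.toReal_le_of_le_ofReal ht hle
      rw [hIr (N.time n ω).toReal (fun u hu => ⟨fun h =>
          (ENNReal.ofReal_le_iff_le_toReal hfin).1 h.1, fun h =>
          ⟨(ENNReal.ofReal_le_iff_le_toReal hfin).2 h, h.trans hτ⟩⟩) (hτ.trans htT),
        hN.lintegral_weighted_hazard hT n (H ω) ENNReal.toReal_nonneg (hτ.trans htT),
        Set.indicator_of_notMem (by exact hlt), add_zero]
      exact (if_pos hle).symm
  have hsm : Measurable fun ω => p.survival n (H ω) t :=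
    measurable_comp₂ (f := p.survival n) (p.measurable_survival n) hHm measurable_const
  have htm : MeasurableSet {ω | ENNReal.ofReal t < N.time n ω} :=
    measurableSet_lt measurable_const (N.measurable_time n)
  have hint := setLIntegral_congr_fun (μ := P) (hRm.inter hBm) hpt
  rw [lintegral_add_right _ hsm, lintegral_add_left hJm, ← hkey, lintegral_indicator_one htm,
    Measure.restrict_apply htm,
    Set.inter_comm {ω | ENNReal.ofReal t < N.time n ω}] at hint
  have hJfin : ∫⁻ ω in R ∩ H ⁻¹' B, J ω ∂P ≠ ∞ := by
    refine ne_top_of_le_ne_top (measure_ne_top P (R ∩ H ⁻¹' B)) ?_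
    rw [← setLIntegral_one]
    refine lintegral_mono fun ω => ?_
    simp only [J]
    split_ifs with h
    · exact p.weight_le_one (hcum _ htT) (ENNReal.toReal_le_of_le_ofReal ht h)
    · exact zero_le
  exact ((ENNReal.add_right_inj hJfin).1 hint).symm

end HawkesParams.IsMarkedHawkes

/-! ### The law of the realization of the Hawkes process -/

namespace HawkesParams

variable (p : HawkesParams)

open Classical in
/-- The density of the next event (time, side, mark) by time `T`, given the first `n` events. -/
def nextDensity (T : ℝ) (n : ℕ) (x : Fin n → ℝ × Fin 2 × ℝ) (y : ℝ × Fin 2 × ℝ) : ℝ≥0∞ :=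
  if y.1 ∈ Set.Ioc 0 T then
    p.hazard y.2.1 n x y.1 * p.survival n x y.1 * exponentialPDF (p.rate y.2.1) y.2.2 else 0

lemma measurable_nextDensity (T : ℝ) (n : ℕ) :
    Measurable (Function.uncurry (p.nextDensity T n)) := by
  classical
  unfold nextDensity Function.uncurry
  refine Measurable.ite (measurable_snd.fst measurableSet_Ioc) ?_ measurable_const
  refine (Measurable.mul ?_ ?_).mul ?_
  · have : Measurable fun w : Fin 2 × ((Fin n → ℝ × Fin 2 × ℝ) × ℝ) =>
        p.hazard w.1 n w.2.1 w.2.2 :=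
      measurable_from_prod_countable_right fun i => p.measurable_hazard i n
    exact measurable_comp₂ (f := fun i (w : (Fin n → ℝ × Fin 2 × ℝ) × ℝ) => p.hazard i n w.1 w.2)
      this measurable_snd.snd.fst (measurable_fst.prodMk measurable_snd.fst)
  · exact measurable_comp₂ (f := p.survival n) (p.measurable_survival n) measurable_fst
      measurable_snd.fst
  · have : Measurable fun w : Fin 2 × ℝ => exponentialPDF (p.rate w.1) w.2 :=
      measurable_from_prod_countable_right fun i => measurable_exponentialPDF' (p.rate i)
    exact measurable_comp₂ (f := fun i => exponentialPDF (p.rate i)) this measurable_snd.snd.fst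
      measurable_snd.snd.snd

lemma lintegral_nextDensity_prod {T : ℝ} {n : ℕ} (x : Fin n → ℝ × Fin 2 × ℝ) {S : Set ℝ}
    (hS : MeasurableSet S) (J : Set (Fin 2)) (K : Set ℝ) :
    ∫⁻ y in S ×ˢ J ×ˢ K, p.nextDensity T n x y ∂(volume.prod (Measure.count.prod volume))
      = ∑ i, J.indicator (fun i => (∫⁻ u in Set.Ioc 0 T,
          S.indicator 1 u * p.hazard i n x u * p.survival n x u) * p.markLaw i K) i := by
  classical
  have hm : Measurable (p.nextDensity T n x) :=
    measurable_comp₂ (f := p.nextDensity T n) (p.measurable_nextDensity T n) measurable_const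
      measurable_id
  have hhaz : ∀ i, Measurable fun u => p.hazard i n x u * p.survival n x u := fun i =>
    (measurable_comp₂ (f := p.hazard i n) (p.measurable_hazard i n) measurable_const
      measurable_id).mul (measurable_comp₂ (f := p.survival n) (p.measurable_survival n)
      measurable_const measurable_id)
  rw [← Measure.prod_restrict, ← Measure.prod_restrict, lintegral_prod _ hm.aemeasurable]
  have h1 : ∀ u, ∫⁻ z, p.nextDensity T n x (u, z) ∂((Measure.count.restrict J).prod
        (volume.restrict K))
      = ∑ i, J.indicator (fun i => (Set.Ioc 0 T).indicator (fun u =>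
          p.hazard i n x u * p.survival n x u) u * p.markLaw i K) i := by
    intro u
    have hmu : Measurable fun z => p.nextDensity T n x (u, z) := hm.comp measurable_prodMk_left
    rw [lintegral_prod _ hmu.aemeasurable, ← lintegral_indicator (Set.to_countable J).measurableSet,
      lintegral_count, tsum_fintype]
    refine Finset.sum_congr rfl fun i _ => ?_
    refine congrArg (fun f => J.indicator f i) (funext fun j => ?_)
    by_cases hu : u ∈ Set.Ioc 0 T
    · simp only [nextDensity, hu, if_true]
      rw [lintegral_const_mul _ (measurable_exponentialPDF' _), Set.indicator_of_mem hu, markLaw]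
    · simp [nextDensity, hu]
  simp_rw [h1]
  rw [lintegral_finsetSum]
  · refine Finset.sum_congr rfl fun i _ => ?_
    by_cases hi : i ∈ J
    · simp only [Set.indicator_of_mem hi]
      rw [lintegral_mul_const' _ _ (p.markLaw_ne_top i K)]
      congr 1
      rw [← lintegral_indicator hS, ← lintegral_indicator measurableSet_Ioc]
      refine lintegral_congr fun u => ?_
      by_cases h : u ∈ S <;> by_cases h' : u ∈ Set.Ioc 0 T <;> simp [h, h']
    · simp [hi]
  · intro i _
    by_cases hi : i ∈ J
    · simp only [Set.indicator_of_mem hi]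
      exact ((hhaz i).indicator measurableSet_Ioc).mul_const _
    · simp only [Set.indicator_of_notMem hi]
      exact measurable_const

end HawkesParams

namespace HawkesParams.IsMarkedHawkes

variable {Ω : Type*} [MeasurableSpace Ω] {p : HawkesParams} {N : MarkedPointProcess Ω}
  {P : Measure Ω} {T : ℝ}

lemma ae_finite_events (hN : p.IsMarkedHawkes N P T) :
    ∀ᵐ ω ∂P, {k | N.time k ω ≤ ENNReal.ofReal T}.Finite := by
  classical
  have hm : ∀ k, MeasurableSet {ω | N.time k ω ≤ ENNReal.ofReal T} := fun k =>
    measurableSet_le (N.measurable_time k) measurable_const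
  have h : ∑' k, P {ω | N.time k ω ≤ ENNReal.ofReal T} ≠ ∞ := by
    have h1 : ∑' k, P {ω | N.time k ω ≤ ENNReal.ofReal T}
        = ∫⁻ ω, (N.count 0 0 T Set.univ ω + N.count 1 0 T Set.univ ω) ∂P := by
      simp_rw [MarkedPointProcess.count_add_count]
      rw [lintegral_tsum fun k =>
        (Measurable.ite (hm k) measurable_const measurable_const).aemeasurable]
      refine tsum_congr fun k => ?_
      rw [← lintegral_indicator_one (hm k)]
      exact lintegral_congr fun ω => by simp [Set.indicator_apply]
    rw [h1, lintegral_add_left (N.measurable_count 0 0 T .univ)]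
    exact (ENNReal.add_lt_top.2 ⟨hN.lintegral_count_lt_top 0, hN.lintegral_count_lt_top 1⟩).ne
  exact ae_finite_setOfPred_mem h

variable [IsProbabilityMeasure P]

open Classical in
/-- The form of `measure_survival` for functions of the first `n` events. -/
lemma lintegral_survival (hN : p.IsMarkedHawkes N P T) (hT : 0 ≤ T) (n : ℕ) {t : ℝ} (ht : 0 ≤ t)
    (htT : t ≤ T) {φ : (Fin n → ℝ × Fin 2 × ℝ) → ℝ≥0∞} (hφ : Measurable φ) :
    ∫⁻ ω in reached N.time (ENNReal.ofReal T) n,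
        (if ENNReal.ofReal t < N.time n ω then φ (firstPoints N.point n ω) else 0) ∂P
      = ∫⁻ ω in reached N.time (ENNReal.ofReal T) n,
          φ (firstPoints N.point n ω) * p.survival n (firstPoints N.point n ω) t ∂P := by
  set R := reached N.time (ENNReal.ofReal T) n
  have hRm : MeasurableSet R := measurableSet_reached N.measurable_time _ n
  have hHm : Measurable (firstPoints N.point n) := measurable_firstPoints N.measurable_point n
  have hsm : Measurable fun x => p.survival n x t :=
    measurable_comp₂ (f := p.survival n) (p.measurable_survival n) measurable_id measurable_const
  have htm : MeasurableSet {ω | ENNReal.ofReal t < N.time n ω} :=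
    measurableSet_lt measurable_const (N.measurable_time n)
  have hmeas : (P.restrict ({ω | ENNReal.ofReal t < N.time n ω} ∩ R)).map (firstPoints N.point n)
      = ((P.restrict R).map (firstPoints N.point n)).withDensity fun x => p.survival n x t := by
    ext B hB
    rw [Measure.map_apply hHm hB, Measure.restrict_apply (hHm hB), withDensity_apply _ hB,
      setLIntegral_map hB hsm hHm, Measure.restrict_restrict (hHm hB),
      Set.inter_comm (firstPoints N.point n ⁻¹' B) R,
      ← hN.measure_survival hT n ht htT hB]
    congr 1
    ext ω
    simp only [Set.mem_inter_iff]
    tauto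
  have h1 := lintegral_map (μ := P.restrict ({ω | ENNReal.ofReal t < N.time n ω} ∩ R)) hφ hHm
  rw [hmeas, lintegral_withDensity_eq_lintegral_mul _ hsm hφ,
    lintegral_map (hsm.mul hφ) hHm, ← Measure.restrict_restrict htm,
    ← lintegral_indicator htm] at h1
  refine Eq.trans ?_ (h1.symm.trans ?_)
  · exact lintegral_congr fun ω => by simp [Set.indicator_apply]
  · exact lintegral_congr fun ω => mul_comm _ _

/-- The joint law of the first `n` events and of the next one, in terms of the hazard and of the
survival probability of the first `n` events. -/
lemma lintegral_next_event_survival (hN : p.IsMarkedHawkes N P T) (hT : 0 ≤ T) (n : ℕ) (i : Fin 2)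
    {K : Set ℝ} (hK : MeasurableSet K) {ψ : (Fin n → ℝ × Fin 2 × ℝ) × ℝ → ℝ≥0∞}
    (hψ : Measurable ψ) :
    ∫⁻ ω in {ω | N.time n ω ≤ ENNReal.ofReal T ∧ N.side n ω = i ∧ N.mark n ω ∈ K},
        ψ (firstPoints N.point n ω, (N.time n ω).toReal) ∂P
      = (∫⁻ ω in reached N.time (ENNReal.ofReal T) n, (∫⁻ u in Set.Ioc 0 T,
          ψ (firstPoints N.point n ω, u) * p.hazard i n (firstPoints N.point n ω) u
            * p.survival n (firstPoints N.point n ω) u) ∂P) * p.markLaw i K := by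
  classical
  have hHm : Measurable (firstPoints N.point n) := measurable_firstPoints N.measurable_point n
  rw [hN.lintegral_next_event hT n i hK hψ]
  congr 1
  let φ : (Fin n → ℝ × Fin 2 × ℝ) × ℝ → ℝ≥0∞ := fun z => ψ z * p.hazard i n z.1 z.2
  have hφ : Measurable φ := hψ.mul (p.measurable_hazard i n)
  have hHu : Measurable fun z : Ω × ℝ => (firstPoints N.point n z.1, z.2) :=
    (hHm.comp measurable_fst).prodMk measurable_snd
  have hφ1 : Measurable fun z : Ω × ℝ => φ (firstPoints N.point n z.1, z.2) := hφ.comp hHu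
  have hm1 : Measurable fun z : Ω × ℝ => if ENNReal.ofReal z.2 < N.time n z.1 then
      φ (firstPoints N.point n z.1, z.2) else 0 :=
    Measurable.ite (measurableSet_lt measurable_snd.ennreal_ofReal
      ((N.measurable_time n).comp measurable_fst)) hφ1 measurable_const
  have hm2 : Measurable fun z : Ω × ℝ => φ (firstPoints N.point n z.1, z.2)
      * p.survival n (firstPoints N.point n z.1) z.2 :=
    hφ1.mul (measurable_comp₂ (f := p.survival n) (p.measurable_survival n)
      (hHm.comp measurable_fst) measurable_snd)
  calc _ = ∫⁻ ω in reached N.time (ENNReal.ofReal T) n, (∫⁻ u in Set.Ioc 0 T,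
          if ENNReal.ofReal u < N.time n ω then φ (firstPoints N.point n ω, u) else 0) ∂P := by
        refine lintegral_congr fun ω => lintegral_congr_ae ?_
        -- the event time itself is a null set of times
        filter_upwards [ae_restrict_of_ae (compl_mem_ae_iff.2
          (Real.volume_singleton (a := (N.time n ω).toReal))),
          ae_restrict_mem measurableSet_Ioc] with u hu hmem
        have hne : ENNReal.ofReal u ≠ N.time n ω := by
          intro h
          refine hu ?_
          rw [Set.mem_singleton_iff, ← h, ENNReal.toReal_ofReal hmem.1.le]
        have : ENNReal.ofReal u ≤ N.time n ω ↔ ENNReal.ofReal u < N.time n ω :=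
          ⟨fun h => h.lt_of_ne hne, le_of_lt⟩
        simp only [this, φ]
    _ = ∫⁻ u in Set.Ioc 0 T, (∫⁻ ω in reached N.time (ENNReal.ofReal T) n,
          (if ENNReal.ofReal u < N.time n ω then φ (firstPoints N.point n ω, u) else 0) ∂P) :=
        lintegral_lintegral_swap hm1.aemeasurable
    _ = ∫⁻ u in Set.Ioc 0 T, (∫⁻ ω in reached N.time (ENNReal.ofReal T) n,
          φ (firstPoints N.point n ω, u) * p.survival n (firstPoints N.point n ω) u ∂P) :=
        setLIntegral_congr_fun measurableSet_Ioc fun u hu =>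
          hN.lintegral_survival hT n hu.1.le hu.2 (φ := fun x => φ (x, u))
            (hφ.comp measurable_prodMk_right)
    _ = _ := (lintegral_lintegral_swap hm2.aemeasurable).symm

/-- Given the first `n` events, the next one by time `T` has the density `nextDensity`. It suffices
to check this on boxes in time, side and mark. -/
lemma measure_next_point (hN : p.IsMarkedHawkes N P T) (hT : 0 ≤ T) (n : ℕ)
    {B : Set (Fin n → ℝ × Fin 2 × ℝ)} {C : Set (ℝ × Fin 2 × ℝ)} (hB : MeasurableSet B)
    (hC : MeasurableSet C) :
    P (reached N.time (ENNReal.ofReal T) (n + 1) ∩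
        (firstPoints N.point n ⁻¹' B ∩ N.point n ⁻¹' C))
      = ∫⁻ ω in reached N.time (ENNReal.ofReal T) n ∩ firstPoints N.point n ⁻¹' B,
          ∫⁻ y in C, p.nextDensity T n (firstPoints N.point n ω) y
            ∂(volume.prod (Measure.count.prod volume)) ∂P := by
  classical
  let κ : Measure (ℝ × Fin 2 × ℝ) := volume.prod (Measure.count.prod volume)
  set R := reached N.time (ENNReal.ofReal T) with hR
  set H := firstPoints N.point n with hH
  have hRm : ∀ n, MeasurableSet (R n) := fun n => measurableSet_reached N.measurable_time _ n
  have hHm : Measurable H := measurable_firstPoints N.measurable_point n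
  have hpm := N.measurable_point n
  have hRn : ∀ ω, ω ∈ R (n + 1) ↔ N.time n ω ≤ ENNReal.ofReal T := fun ω =>
    ⟨fun h => h n n.lt_succ_self, fun h k hk =>
      (N.monotone_time ω (Nat.lt_succ_iff.1 hk)).trans h⟩
  have hdm : Measurable fun z : Ω × (ℝ × Fin 2 × ℝ) => p.nextDensity T n (H z.1) z.2 :=
    measurable_comp₂ (f := p.nextDensity T n) (p.measurable_nextDensity T n)
      (hHm.comp measurable_fst) measurable_snd
  let ν₁ : Measure (ℝ × Fin 2 × ℝ) := (P.restrict (R (n + 1) ∩ H ⁻¹' B)).map (N.point n)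
  let ν₂ : Measure (ℝ × Fin 2 × ℝ) := (((P.restrict (R n ∩ H ⁻¹' B)).prod κ).withDensity
    fun z => p.nextDensity T n (H z.1) z.2).map Prod.snd
  have h₁ : ∀ C, MeasurableSet C → ν₁ C = P (R (n + 1) ∩ (H ⁻¹' B ∩ N.point n ⁻¹' C)) := by
    intro C hC
    simp only [ν₁]
    rw [Measure.map_apply hpm hC, Measure.restrict_apply (hpm hC)]
    congr 1
    ext ω
    simp only [Set.mem_inter_iff]
    tauto
  have h₂ : ∀ C, MeasurableSet C → ν₂ C
      = ∫⁻ ω in R n ∩ H ⁻¹' B, ∫⁻ y in C, p.nextDensity T n (H ω) y ∂κ ∂P := by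
    intro C hC
    simp only [ν₂]
    rw [Measure.map_apply measurable_snd hC, withDensity_apply _ (measurable_snd hC),
      ← Set.univ_prod, ← Measure.prod_restrict, Measure.restrict_univ,
      lintegral_prod _ hdm.aemeasurable]
  have : IsFiniteMeasure ν₁ := Measure.isFiniteMeasure_map _ _
  suffices hν : ν₁ = ν₂ by rw [← h₁ C hC, hν, h₂ C hC]
  refine Measure.ext_prod₃ fun {S J K} hS hJ hK => ?_
  rw [h₁ _ (hS.prod (hJ.prod hK)), h₂ _ (hS.prod (hJ.prod hK))]
  simp_rw [κ, p.lintegral_nextDensity_prod _ hS J K]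
  have hψ : Measurable ((B ×ˢ S).indicator 1 : (Fin n → ℝ × Fin 2 × ℝ) × ℝ → ℝ≥0∞) :=
    measurable_one.indicator (hB.prod hS)
  have hSm : ∀ i, MeasurableSet
      {ω | N.time n ω ≤ ENNReal.ofReal T ∧ N.side n ω = i ∧ N.mark n ω ∈ K} := fun i =>
    (measurableSet_le (N.measurable_time n) measurable_const).inter
      ((N.measurable_side n (measurableSet_singleton i)).inter (N.measurable_mark n hK))
  have htm : MeasurableSet {ω | H ω ∈ B ∧ (N.time n ω).toReal ∈ S} :=
    (hHm hB).inter ((N.measurable_time n).ennreal_toReal hS)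
  have hNX : ∀ i, P ({ω | H ω ∈ B ∧ (N.time n ω).toReal ∈ S} ∩
        {ω | N.time n ω ≤ ENNReal.ofReal T ∧ N.side n ω = i ∧ N.mark n ω ∈ K})
      = ∫⁻ ω in R n ∩ H ⁻¹' B, (∫⁻ u in Set.Ioc 0 T,
          S.indicator 1 u * p.hazard i n (H ω) u * p.survival n (H ω) u) * p.markLaw i K ∂P := by
    intro i
    have h := hN.lintegral_next_event_survival hT n i hK hψ
    have hl : ∫⁻ ω in {ω | N.time n ω ≤ ENNReal.ofReal T ∧ N.side n ω = i ∧ N.mark n ω ∈ K},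
        (B ×ˢ S).indicator 1 (H ω, (N.time n ω).toReal) ∂P
        = P ({ω | H ω ∈ B ∧ (N.time n ω).toReal ∈ S} ∩
        {ω | N.time n ω ≤ ENNReal.ofReal T ∧ N.side n ω = i ∧ N.mark n ω ∈ K}) := by
      rw [← Measure.restrict_apply htm, ← lintegral_indicator_one htm]
      rfl
    rw [← hl, h, Set.inter_comm, ← Measure.restrict_restrict (hHm hB),
      lintegral_mul_const' _ _ (p.markLaw_ne_top i K), ← lintegral_indicator (hHm hB)]
    congr 1
    refine lintegral_congr fun ω => ?_
    by_cases hω : H ω ∈ B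
    · rw [Set.indicator_of_mem (show ω ∈ H ⁻¹' B from hω)]
      refine lintegral_congr fun u => ?_
      by_cases hu : u ∈ S <;> simp [hω, hu, H] at *
    · rw [Set.indicator_of_notMem (show ω ∉ H ⁻¹' B from hω)]
      simp only [Set.indicator_apply, Set.mem_prod]
      have hω' : firstPoints N.point n ω ∉ B := hω
      simp [hω']
  have hsplit : P (R (n + 1) ∩ (H ⁻¹' B ∩ N.point n ⁻¹' S ×ˢ J ×ˢ K))
      = ∑ i, J.indicator (fun i => P ({ω | H ω ∈ B ∧ (N.time n ω).toReal ∈ S} ∩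
        {ω | N.time n ω ≤ ENNReal.ofReal T ∧ N.side n ω = i ∧ N.mark n ω ∈ K})) i := by
    have hU : R (n + 1) ∩ (H ⁻¹' B ∩ N.point n ⁻¹' S ×ˢ J ×ˢ K)
        = ⋃ i, {ω | i ∈ J ∧ ω ∈ {ω | H ω ∈ B ∧ (N.time n ω).toReal ∈ S} ∩
          {ω | N.time n ω ≤ ENNReal.ofReal T ∧ N.side n ω = i ∧ N.mark n ω ∈ K}} := by
      ext ω
      simp only [Set.mem_inter_iff, hRn, Set.mem_preimage, Set.mem_prod, Set.mem_iUnion,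
        Set.mem_ofPred_eq, MarkedPointProcess.point]
      constructor
      · rintro ⟨h1, h2, h3, h4, h5⟩
        exact ⟨_, h4, ⟨h2, h3⟩, h1, rfl, h5⟩
      · rintro ⟨i, h4, ⟨h2, h3⟩, h1, rfl, h5⟩
        exact ⟨h1, h2, h3, h4, h5⟩
    rw [hU, measure_iUnion, tsum_fintype]
    · refine Finset.sum_congr rfl fun i _ => ?_
      by_cases hi : i ∈ J
      · rw [Set.indicator_of_mem hi]
        congr 1
        ext ω
        simp [hi]
      · rw [Set.indicator_of_notMem hi]
        simp [hi]
    · intro i j hij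
      refine Set.disjoint_left.2 fun ω h1 h2 => hij ?_
      exact h1.2.2.2.1.symm.trans h2.2.2.2.1
    · intro i
      exact (MeasurableSet.const _).inter (htm.inter (hSm i))
  rw [hsplit, lintegral_finsetSum]
  · refine Finset.sum_congr rfl fun i _ => ?_
    by_cases hi : i ∈ J
    · simp only [Set.indicator_of_mem hi]
      exact hNX i
    · simp [hi]
  · intro i _
    by_cases hi : i ∈ J
    · simp only [Set.indicator_of_mem hi]
      have hm : Measurable fun z : Ω × ℝ => S.indicator 1 z.2 * p.hazard i n (H z.1) z.2
          * p.survival n (H z.1) z.2 := by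
        refine (Measurable.mul ?_ ?_).mul ?_
        · exact (measurable_one.indicator hS).comp measurable_snd
        · exact measurable_comp₂ (f := p.hazard i n) (p.measurable_hazard i n)
            (hHm.comp measurable_fst) measurable_snd
        · exact measurable_comp₂ (f := p.survival n) (p.measurable_survival n)
            (hHm.comp measurable_fst) measurable_snd
      exact hm.lintegral_prod_right'.mul_const _
    · simp only [Set.indicator_of_notMem hi]
      exact measurable_const

/-- The density of the law of the realization on `[0, T]`. -/
theorem map_path_eq_withDensity (hN : p.IsMarkedHawkes N P T) (hT : 0 ≤ T) :
    P.map (N.path T) = MarkedPointProcess.pathMeasure.withDensity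
      (janossy (p.nextDensity T) fun n x => p.survival n x T) := by
  have hsm : ∀ n, Measurable fun x => p.survival n x T := fun n =>
    measurable_comp₂ (f := p.survival n) (p.measurable_survival n) measurable_id measurable_const
  exact map_observe_eq_withDensity P T N.measurable_time N.measurable_point
    (ae_of_all _ N.monotone_time) hN.ae_finite_events _ (p.measurable_nextDensity T) hsm
    (fun n B C hB hC => hN.measure_next_point hT n hB hC)
    (fun n B hB => hN.measure_survival hT n hT le_rfl hB)

end HawkesParams.IsMarkedHawkes

/-! ### Closed forms of the impact functions and of the integrated intensity -/

lemma integral_rpow_expMeasure {r η : ℝ} (hr : 0 < r) (hη : 0 ≤ η) :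
    ∫ x, x ^ η ∂(expMeasure r) = Real.Gamma (1 + η) / r ^ η := by
  have he : expMeasure r = volume.withDensity (exponentialPDF r) := rfl
  have h1 : ∀ x : ℝ, (exponentialPDF r x).toReal • x ^ η
      = (Set.Ici 0).indicator (fun x => r * (x ^ (η + 1 - 1) * Real.exp (-(r * x)))) x := by
    intro x
    by_cases hx : 0 ≤ x
    · have h : 0 ≤ r * Real.exp (-(r * x)) := by positivity
      rw [Set.indicator_of_mem (Set.mem_Ici.2 hx), exponentialPDF_of_nonneg hx,
        ENNReal.toReal_ofReal h, add_sub_cancel_right, smul_eq_mul]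
      ring
    · rw [Set.indicator_of_notMem (by simpa using hx), exponentialPDF_of_neg (not_le.1 hx)]
      simp
  rw [he, integral_withDensity_eq_integral_toReal_smul (measurable_exponentialPDF' r)
    (ae_of_all _ fun x => ENNReal.ofReal_lt_top)]
  simp_rw [h1]
  rw [integral_indicator measurableSet_Ici, integral_Ici_eq_integral_Ioi, integral_const_mul,
    Real.integral_rpow_mul_exp_neg_mul_Ioi (by linarith) hr, one_div, Real.inv_rpow hr.le,
    Real.rpow_add hr, Real.rpow_one, add_comm 1 η]
  field_simp

namespace HawkesParams

variable {Ω : Type*} [MeasurableSpace Ω] (p : HawkesParams) (N : MarkedPointProcess Ω)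

lemma impact_eq (j : Fin 2) (v : ℝ) :
    p.impact j v = p.rate j ^ p.η j / Real.Gamma (1 + p.η j) * v ^ p.η j := by
  rw [impact, integral_rpow_expMeasure (p.rate_pos j) (p.η_nonneg j), div_div_eq_mul_div]
  ring

lemma impact_nonneg (j : Fin 2) {v : ℝ} (hv : 0 ≤ v) : 0 ≤ p.impact j v := by
  have h1 := p.rate_pos j
  have h2 : 0 < Real.Gamma (1 + p.η j) := Real.Gamma_pos_of_pos (by linarith [p.η_nonneg j])
  rw [impact_eq]
  positivity

lemma excitation_nonneg (i : Fin 2) (k : ℕ) (ω : Ω) (u : ℝ) :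
    0 ≤ p.excitation i (N.point k ω) u :=
  mul_nonneg (mul_nonneg (p.α_nonneg _ _) (Real.exp_pos _).le)
    (p.impact_nonneg _ (N.mark_nonneg k ω))

/-- The contribution of an event `x` to the intensity of coordinate `i`, integrated over the times
from the event to `T`. -/
def totalExcitation (i : Fin 2) (x : ℝ × Fin 2 × ℝ) (T : ℝ) : ℝ :=
  p.α i x.2.1 / p.β i x.2.1 * p.impact x.2.1 x.2.2 * (1 - Real.exp (-p.β i x.2.1 * (T - x.1)))

lemma integral_excitation (i : Fin 2) (x : ℝ × Fin 2 × ℝ) (T : ℝ) :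
    ∫ u in x.1..T, p.excitation i x u = p.totalExcitation i x T := by
  have hβ : p.β i x.2.1 ≠ 0 := (p.β_pos _ _).ne'
  have hd : ∀ u ∈ Set.uIcc x.1 T, HasDerivAt (fun u => -(p.α i x.2.1 / p.β i x.2.1 *
      p.impact x.2.1 x.2.2) * Real.exp (-p.β i x.2.1 * (u - x.1))) (p.excitation i x u) u := by
    intro u _
    have h := ((((hasDerivAt_id u).sub_const x.1).const_mul (-p.β i x.2.1)).exp).const_mul
      (-(p.α i x.2.1 / p.β i x.2.1 * p.impact x.2.1 x.2.2))
    refine h.congr_deriv ?_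
    simp only [excitation, id]
    field_simp
  rw [intervalIntegral.integral_eq_sub_of_hasDerivAt hd
    (Continuous.intervalIntegrable (by unfold excitation; fun_prop) _ _), totalExcitation]
  simp only [sub_self, mul_zero, Real.exp_zero]
  ring

lemma totalExcitation_nonneg (i : Fin 2) (k : ℕ) (ω : Ω) {T : ℝ}
    (h : N.time k ω ≤ ENNReal.ofReal T) (hT : 0 ≤ T) :
    0 ≤ p.totalExcitation i (N.point k ω) T := by
  rw [← integral_excitation]
  refine intervalIntegral.integral_nonneg_of_forall ?_ fun u => p.excitation_nonneg N i k ω u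
  exact (ENNReal.toReal_mono ENNReal.ofReal_ne_top h).trans_eq (ENNReal.toReal_ofReal hT)

lemma lintegral_excitation (i : Fin 2) (k : ℕ) (ω : Ω) {T : ℝ}
    (h : N.time k ω ≤ ENNReal.ofReal T) (hT : 0 ≤ T) :
    ∫⁻ u in Set.Ioc (N.time k ω).toReal T, ENNReal.ofReal (p.excitation i (N.point k ω) u)
      = ENNReal.ofReal (p.totalExcitation i (N.point k ω) T) := by
  have hle : (N.time k ω).toReal ≤ T :=
    (ENNReal.toReal_mono ENNReal.ofReal_ne_top h).trans_eq (ENNReal.toReal_ofReal hT)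
  have hc : Continuous (p.excitation i (N.point k ω)) := by unfold excitation; fun_prop
  rw [← integral_excitation, show (N.point k ω).1 = (N.time k ω).toReal from rfl,
    intervalIntegral.integral_of_le hle,
    ofReal_integral_eq_lintegral_ofReal]
  · exact (hc.intervalIntegrable _ _).1
  · exact ae_of_all _ fun u => p.excitation_nonneg N i k ω u

open Classical in
lemma groundIntensity_eq_sum (i : Fin 2) {T u : ℝ} (hu : u ≤ T) {ω : Ω} {n : ℕ}
    (hn : ENNReal.ofReal T < N.time n ω) :
    p.groundIntensity N i u ω = ENNReal.ofReal (p.μ i u) + ∑ k ∈ Finset.range n,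
      if N.time k ω < ENNReal.ofReal u then ENNReal.ofReal (p.excitation i (N.point k ω) u)
      else 0 := by
  rw [groundIntensity_eq, tsum_eq_sum (s := Finset.range n)]
  intro k hk
  rw [if_neg]
  refine not_lt.2 (((ENNReal.ofReal_le_ofReal hu).trans hn.le).trans
    (N.monotone_time ω (not_lt.1 (Finset.mem_range.not.1 hk))))

lemma lintegral_groundIntensity (i : Fin 2) {T : ℝ} (hT : 0 ≤ T)
    (hμ : ∫⁻ u in Set.Ioc 0 T, ENNReal.ofReal (p.μ i u) ≠ ∞) {ω : Ω} {n : ℕ}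
    (h1 : ∀ k < n, N.time k ω ≤ ENNReal.ofReal T) (h2 : ENNReal.ofReal T < N.time n ω) :
    ∫⁻ u in Set.Ioc 0 T, p.groundIntensity N i u ω = ENNReal.ofReal ((∫ u in (0 : ℝ)..T, p.μ i u)
      + ∑ k ∈ Finset.range n, p.totalExcitation i (N.point k ω) T) := by
  classical
  have hμ0 : ∀ᵐ u ∂volume.restrict (Set.Ioc 0 T), 0 ≤ p.μ i u := by
    filter_upwards [ae_restrict_mem measurableSet_Ioc] with u hu using p.μ_nonneg i u hu.1.le
  have hμi : IntegrableOn (p.μ i) (Set.Ioc 0 T) := by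
    refine ⟨(p.measurable_μ i).aestronglyMeasurable, ?_⟩
    rw [hasFiniteIntegral_iff_ofReal hμ0]
    exact hμ.lt_top
  have hexc : ∀ k, Measurable fun u => if N.time k ω < ENNReal.ofReal u then
      ENNReal.ofReal (p.excitation i (N.point k ω) u) else 0 := fun k =>
    Measurable.ite (measurableSet_lt measurable_const (by fun_prop))
      (measurable_comp₂ (f := p.excitation i) (p.measurable_excitation i) measurable_const
        measurable_id).ennreal_ofReal measurable_const
  rw [setLIntegral_congr_fun measurableSet_Ioc
    (fun u hu => p.groundIntensity_eq_sum N i hu.2 h2),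
    lintegral_add_left (p.measurable_μ i).ennreal_ofReal, lintegral_finsetSum _ fun k _ => hexc k,
    ← ofReal_integral_eq_lintegral_ofReal hμi hμ0, ← intervalIntegral.integral_of_le hT,
    ENNReal.ofReal_add, ENNReal.ofReal_sum_of_nonneg]
  · congr 1
    refine Finset.sum_congr rfl fun k hk => ?_
    have hk' := h1 k (Finset.mem_range.1 hk)
    rw [← p.lintegral_excitation N i k ω hk' hT, ← lintegral_indicator measurableSet_Ioc,
      ← lintegral_indicator measurableSet_Ioc]
    refine lintegral_congr fun u => ?_
    have hlt : N.time k ω < ENNReal.ofReal u ↔ (N.time k ω).toReal < u :=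
      ENNReal.lt_ofReal_iff_toReal_lt (hk'.trans_lt ENNReal.ofReal_lt_top).ne
    have h0 : 0 ≤ (N.time k ω).toReal := ENNReal.toReal_nonneg
    simp only [Set.indicator_apply, Set.mem_Ioc, hlt]
    by_cases h3 : (N.time k ω).toReal < u
    · simp [h3, h0.trans_lt h3]
    · simp [h3]
  · exact fun k hk => p.totalExcitation_nonneg N i k ω (h1 k (Finset.mem_range.1 hk)) hT
  · exact intervalIntegral.integral_nonneg hT fun u hu => p.μ_nonneg i u hu.1
  · exact Finset.sum_nonneg fun k hk =>
      p.totalExcitation_nonneg N i k ω (h1 k (Finset.mem_range.1 hk)) hT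

/-- Here `c` is the time of the `k`-th event if that happens by `T`, and `T` otherwise. -/
lemma cumHazard_firstPoints {T c : ℝ} (hc : c ≤ T) {ω : Ω} {k : ℕ}
    (hk : ω ∈ reached N.time (ENNReal.ofReal T) k)
    (h : ∀ u ∈ Set.Ioc 0 T, ENNReal.ofReal u ≤ N.time k ω ↔ u ≤ c) :
    p.cumHazard k (firstPoints N.point k ω) c
      = ∑ i, ∫⁻ u in Set.Ioc 0 T,
          (N.window k T).indicator (fun _ => 1) (ω, u) * p.groundIntensity N i u ω := by
  classical
  unfold cumHazard totalHazard
  have hm : ∀ i, Measurable fun u => p.hazard i k (firstPoints N.point k ω) u := fun i =>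
    measurable_comp₂ (f := p.hazard i k) (p.measurable_hazard i k) measurable_const measurable_id
  rw [lintegral_finsetSum _ fun i _ => hm i]
  refine Finset.sum_congr rfl fun i _ => ?_
  rw [← lintegral_indicator measurableSet_Ioc, ← lintegral_indicator measurableSet_Ioc]
  refine lintegral_congr fun u => ?_
  by_cases hu : u ∈ Set.Ioc 0 T
  · have h3 := IsMarkedHawkes.indicator_window_mul (p := p) (N := N) i k (fun _ => 1) ω hu
    rw [Set.indicator_of_mem hu, h3, if_pos hk, one_mul, Set.indicator_apply]
    simp only [h u hu, Set.mem_Ioc, hu.1, true_and]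
  · rw [Set.indicator_of_notMem hu, Set.indicator_of_notMem]
    exact fun h' => hu ⟨h'.1, h'.2.trans hc⟩

/-- The integrated hazards between consecutive events add up to the integrated intensity. -/
lemma sum_cumHazard {T : ℝ} (hT : 0 ≤ T) {ω : Ω} {n : ℕ}
    (h1 : ∀ k < n, N.time k ω ≤ ENNReal.ofReal T) (h2 : ENNReal.ofReal T < N.time n ω) :
    ∑ k ∈ Finset.range n, p.cumHazard k (firstPoints N.point k ω) (N.time k ω).toReal
        + p.cumHazard n (firstPoints N.point n ω) T
      = ∑ i, ∫⁻ u in Set.Ioc 0 T, p.groundIntensity N i u ω := by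
  classical
  have hr : ∀ k ≤ n, ω ∈ reached N.time (ENNReal.ofReal T) k := fun k hk l hl =>
    h1 l (hl.trans_le hk)
  have hlast := p.cumHazard_firstPoints N le_rfl (hr n le_rfl) fun u hu => by
    simp [hu.2, (ENNReal.ofReal_le_ofReal hu.2).trans h2.le]
  have hstep : ∀ k ∈ Finset.range n,
      p.cumHazard k (firstPoints N.point k ω) (N.time k ω).toReal = ∑ i, ∫⁻ u in Set.Ioc 0 T,
          (N.window k T).indicator (fun _ => 1) (ω, u) * p.groundIntensity N i u ω := by
    intro k hk
    have hk' := h1 k (Finset.mem_range.1 hk)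
    refine p.cumHazard_firstPoints N ?_ (hr k (Finset.mem_range.1 hk).le) fun u hu => ?_
    · exact (ENNReal.toReal_mono ENNReal.ofReal_ne_top hk').trans_eq (ENNReal.toReal_ofReal hT)
    · exact ENNReal.ofReal_le_iff_le_toReal (hk'.trans_lt ENNReal.ofReal_lt_top).ne
  have hm : ∀ i k, Measurable fun u =>
      (N.window k T).indicator (fun _ => (1 : ℝ≥0∞)) (ω, u) * p.groundIntensity N i u ω := by
    intro i k
    have hw := N.predictable_le T _ (N.measurableSet_predictable_window k T)
    exact ((measurable_const.indicator hw).mul (p.measurable_groundIntensity N i)).comp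
      measurable_prodMk_left
  rw [hlast, Finset.sum_congr rfl hstep, ← Finset.sum_range_succ, Finset.sum_comm]
  refine Finset.sum_congr rfl fun i _ => ?_
  rw [← lintegral_finsetSum _ fun k _ => hm i k]
  refine setLIntegral_congr_fun measurableSet_Ioc fun u hu => ?_
  rw [← Finset.sum_mul]
  -- `u` lies in exactly one of the windows
  have hex : ∃ k, ENNReal.ofReal u ≤ N.time k ω :=
    ⟨n, (ENNReal.ofReal_le_ofReal hu.2).trans h2.le⟩
  have hle : Nat.find hex ≤ n := Nat.find_min' hex ((ENNReal.ofReal_le_ofReal hu.2).trans h2.le)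
  rw [Finset.sum_eq_single (Nat.find hex), Set.indicator_of_mem, one_mul]
  · exact ⟨hu, fun k hk => not_le.1 (Nat.find_min hex hk), Nat.find_spec hex⟩
  · intro k _ hk
    refine Set.indicator_of_notMem (fun hw => hk ?_) _
    exact ((Nat.find_eq_iff hex).2 ⟨hw.2.2, fun m hm => not_le.2 (hw.2.1 m hm)⟩).symm
  · exact fun h => absurd (Finset.mem_range.2 (Nat.lt_succ_of_le hle)) h

end HawkesParams

/-! ### Evaluation of the two likelihoods at the observed realization -/

/-- Null sets of realizations of points stay null when marks are attached to the points. -/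
lemma absolutelyContinuous_map_fst_realizationMeasure {X Y : Type*} [MeasurableSpace X]
    [MeasurableSpace Y] (κ : Measure X) (ν : Measure Y) [SigmaFinite κ] [SigmaFinite ν] :
    (realizationMeasure (κ.prod ν)).map (fun r => realizationOf r.1 fun k => (r.2 k).1)
      ≪ realizationMeasure κ := by
  have hm : Measurable fun r : Realization (X × Y) => realizationOf r.1 fun k => (r.2 k).1 :=
    measurable_realization_iff.2 fun n => (measurable_realization_mk n).comp (by fun_prop)
  refine Measure.AbsolutelyContinuous.mk fun A hA h => ?_
  rw [realizationMeasure_apply κ hA, ENNReal.tsum_eq_zero] at h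
  rw [Measure.map_apply hm hA, realizationMeasure_apply _ (hm hA), ENNReal.tsum_eq_zero]
  intro n
  have hp := measurePreserving_arrowProdEquivProdArrow X Y (Fin n) (fun _ => κ) fun _ => ν
  have hs : realizationOf n ⁻¹' ((fun r : Realization (X × Y) =>
      realizationOf r.1 fun k => (r.2 k).1) ⁻¹' A)
      = MeasurableEquiv.arrowProdEquivProdArrow X Y (Fin n) ⁻¹'
          ((realizationOf n ⁻¹' A) ×ˢ Set.univ) := by
    ext x
    simp only [Set.mem_preimage, Set.mem_prod, Set.mem_univ, and_true]
    rfl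
  rw [hs, hp.measure_preimage_equiv, Measure.prod_prod, h n, zero_mul]

namespace MarkedPointProcess

variable {Ω : Type*} [MeasurableSpace Ω] (N : MarkedPointProcess Ω)

lemma measurable_path (T : ℝ) : Measurable (N.path T) :=
  measurable_observe T N.measurable_time N.measurable_point

/-- A sum over the coordinates and over their events is a sum over all events. -/
lemma sum_events (T : ℝ) (ω : Ω) (F : Fin 2 → ℕ → ℝ) :
    ∑ i, ∑ k ∈ N.events T i ω, F i k
      = ∑ k ∈ Finset.range {k | N.time k ω ≤ ENNReal.ofReal T}.ncard, F (N.side k ω) k := by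
  simp only [events, Finset.sum_filter]
  rw [Finset.sum_comm]
  simp

end MarkedPointProcess

namespace HawkesParams

variable {Ω : Type*} [MeasurableSpace Ω] (p : HawkesParams) (N : MarkedPointProcess Ω)

/-- The intensity of the coordinate of the `k`-th event at the time of this event. -/
def eventIntensity (k : ℕ) (ω : Ω) : ℝ :=
  p.μ (N.side k ω) (N.time k ω).toReal
    + ∑ l ∈ Finset.range k, p.excitation (N.side k ω) (N.point l ω) (N.time k ω).toReal

lemma hazard_firstPoints {k : ℕ} {ω : Ω} (hk : N.time k ω < ∞) :
    p.hazard (N.side k ω) k (firstPoints N.point k ω) (N.time k ω).toReal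
      = ENNReal.ofReal (p.eventIntensity N k ω) := by
  have hlt : ∀ l, (firstPoints N.point k ω l).1 < (N.time k ω).toReal := fun l =>
    (ENNReal.toReal_lt_toReal ((N.monotone_time ω l.2.le).trans_lt hk).ne hk.ne).2
      (N.time_lt_of_lt l.2 ((N.monotone_time ω l.2.le).trans_lt hk))
  have hnn : ∀ l ∈ Finset.range k,
      0 ≤ p.excitation (N.side k ω) (N.point l ω) (N.time k ω).toReal := fun l _ =>
    p.excitation_nonneg N _ l ω _
  rw [hazard, if_pos hlt, eventIntensity, ENNReal.ofReal_add
    (p.μ_nonneg _ _ ENNReal.toReal_nonneg) (Finset.sum_nonneg hnn),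
    ENNReal.ofReal_sum_of_nonneg hnn, Finset.sum_range]
  rfl

lemma eventIntensity_nonneg (k : ℕ) (ω : Ω) : 0 ≤ p.eventIntensity N k ω :=
  add_nonneg (p.μ_nonneg _ _ ENNReal.toReal_nonneg)
    (Finset.sum_nonneg fun l _ => p.excitation_nonneg N _ l ω _)

/-- The total intensity integrated over `(0, T]` along a path whose events in `[0, T]` are the first
`n` ones. -/
def integratedIntensity (T : ℝ) (n : ℕ) (ω : Ω) : ℝ :=
  ∑ i, ((∫ u in (0 : ℝ)..T, p.μ i u) + ∑ k ∈ Finset.range n, p.totalExcitation i (N.point k ω) T)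

/-- The product of the probabilities of no event between consecutive events. -/
lemma prod_survival {T : ℝ} (hT : 0 ≤ T)
    (hμ : ∀ i, ∫⁻ u in Set.Ioc 0 T, ENNReal.ofReal (p.μ i u) ≠ ∞) {ω : Ω} {n : ℕ}
    (h1 : ∀ k < n, N.time k ω ≤ ENNReal.ofReal T) (h2 : ENNReal.ofReal T < N.time n ω) :
    (∏ k ∈ Finset.range n, p.survival k (firstPoints N.point k ω) (N.time k ω).toReal)
        * p.survival n (firstPoints N.point n ω) T
      = ENNReal.ofReal (Real.exp (-p.integratedIntensity N T n ω)) := by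
  have hle : ∀ k ∈ Finset.range n, (N.time k ω).toReal ≤ T := fun k hk =>
    (ENNReal.toReal_mono ENNReal.ofReal_ne_top (h1 k (Finset.mem_range.1 hk))).trans_eq
      (ENNReal.toReal_ofReal hT)
  have hfin : ∀ k ∈ Finset.range n,
      p.cumHazard k (firstPoints N.point k ω) (N.time k ω).toReal ≠ ∞ := fun k hk =>
    p.cumHazard_ne_top hμ k _ (hle k hk)
  have hnn : ∀ i ∈ Finset.univ, 0 ≤ (∫ u in (0 : ℝ)..T, p.μ i u)
      + ∑ k ∈ Finset.range n, p.totalExcitation i (N.point k ω) T := fun i _ =>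
    add_nonneg (intervalIntegral.integral_nonneg hT fun u hu => p.μ_nonneg i u hu.1)
      (Finset.sum_nonneg fun k hk =>
        p.totalExcitation_nonneg N i k ω (h1 k (Finset.mem_range.1 hk)) hT)
  have h := congrArg ENNReal.toReal (p.sum_cumHazard N hT h1 h2)
  rw [Finset.sum_congr rfl fun i _ => p.lintegral_groundIntensity N i hT (hμ i) h1 h2,
    ← ENNReal.ofReal_sum_of_nonneg hnn, ENNReal.toReal_ofReal (Finset.sum_nonneg hnn),
    ENNReal.toReal_add (ENNReal.sum_ne_top.2 hfin) (p.cumHazard_ne_top hμ n _ le_rfl),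
    ENNReal.toReal_sum hfin] at h
  unfold survival integratedIntensity
  rw [← h, ← ENNReal.ofReal_prod_of_nonneg fun k _ => (Real.exp_pos _).le,
    ← ENNReal.ofReal_mul (Finset.prod_nonneg fun k _ => (Real.exp_pos _).le), ← Real.exp_sum,
    ← Real.exp_add, Finset.sum_neg_distrib, neg_add]

/-- The density of the mark of the `k`-th event. -/
def markDensity (k : ℕ) (ω : Ω) : ℝ :=
  p.rate (N.side k ω) * Real.exp (-p.rate (N.side k ω) * N.mark k ω)

lemma markDensity_pos (k : ℕ) (ω : Ω) : 0 < p.markDensity N k ω :=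
  mul_pos (p.rate_pos _) (Real.exp_pos _)

lemma janossy_path {T : ℝ} (hT : 0 ≤ T)
    (hμ : ∀ i, ∫⁻ u in Set.Ioc 0 T, ENNReal.ofReal (p.μ i u) ≠ ∞) {ω : Ω} {n : ℕ}
    (hn : {k | N.time k ω ≤ ENNReal.ofReal T}.ncard = n)
    (h1 : ∀ k < n, N.time k ω ≤ ENNReal.ofReal T) (h2 : ENNReal.ofReal T < N.time n ω) :
    janossy (p.nextDensity T) (fun n x => p.survival n x T) (N.path T ω)
      = ENNReal.ofReal ((∏ k ∈ Finset.range n, p.eventIntensity N k ω * p.markDensity N k ω)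
          * Real.exp (-p.integratedIntensity N T n ω)) := by
  have hpath : N.path T ω = ⟨n, firstPoints N.point n ω⟩ := by
    subst hn
    rfl
  have hfac : ∀ k ∈ Finset.range n,
      p.nextDensity T k (firstPoints N.point k ω) (N.point k ω)
        = ENNReal.ofReal (p.eventIntensity N k ω * p.markDensity N k ω)
          * p.survival k (firstPoints N.point k ω) (N.time k ω).toReal := by
    intro k hk
    have hk' := h1 k (Finset.mem_range.1 hk)
    have hfin := hk'.trans_lt ENNReal.ofReal_lt_top
    have hmem : (N.point k ω).1 ∈ Set.Ioc 0 T :=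
      ⟨ENNReal.toReal_pos (N.time_pos k ω).ne' hfin.ne,
        (ENNReal.toReal_mono ENNReal.ofReal_ne_top hk').trans_eq (ENNReal.toReal_ofReal hT)⟩
    rw [nextDensity, if_pos hmem]
    simp only [MarkedPointProcess.point]
    have hh := p.hazard_firstPoints N hfin
    rw [exponentialPDF_of_nonneg (N.mark_nonneg k ω), ENNReal.ofReal_mul
      (p.eventIntensity_nonneg N k ω), ← hh, markDensity, neg_mul]
    ring
  have hchain : chainDensity (p.nextDensity T) n (firstPoints N.point n ω)
      = ∏ k ∈ Finset.range n, p.nextDensity T k (firstPoints N.point k ω) (N.point k ω) :=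
    (Finset.prod_range fun k =>
      p.nextDensity T k (firstPoints N.point k ω) (N.point k ω)).symm
  have hnn : ∀ k ∈ Finset.range n, 0 ≤ p.eventIntensity N k ω * p.markDensity N k ω :=
    fun k _ => mul_nonneg (p.eventIntensity_nonneg N k ω) (p.markDensity_pos N k ω).le
  rw [hpath, janossy, hchain, Finset.prod_congr rfl hfac, Finset.prod_mul_distrib, mul_assoc,
    p.prod_survival N hT hμ h1 h2, ENNReal.ofReal_mul (Finset.prod_nonneg hnn),
    ENNReal.ofReal_prod_of_nonneg hnn]

end HawkesParams

namespace HawkesParams.IsMarkedHawkes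

variable {Ω : Type*} [MeasurableSpace Ω] {p : HawkesParams} {N : MarkedPointProcess Ω}
  {P : Measure Ω} [IsProbabilityMeasure P] {T : ℝ}

lemma map_path_absolutelyContinuous (hN : p.IsMarkedHawkes N P T) (hT : 0 ≤ T) :
    P.map (N.path T) ≪ MarkedPointProcess.pathMeasure := by
  rw [hN.map_path_eq_withDensity hT]
  exact withDensity_absolutelyContinuous _ _

/-- The likelihood agrees almost everywhere with the Janossy density, and the density of the law of a
random variable does not vanish at this variable, almost surely. -/
lemma ae_likelihood_path (hN : p.IsMarkedHawkes N P T) (hT : 0 ≤ T) :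
    ∀ᵐ ω ∂P, N.likelihood P T (N.path T ω)
        = janossy (p.nextDensity T) (fun n x => p.survival n x T) (N.path T ω) ∧
      janossy (p.nextDensity T) (fun n x => p.survival n x T) (N.path T ω) ≠ 0 := by
  have hJ : Measurable (janossy (p.nextDensity T) fun n x => p.survival n x T) :=
    measurable_janossy (p.measurable_nextDensity T) fun n =>
      measurable_comp₂ (f := p.survival n) (p.measurable_survival n) measurable_id measurable_const
  have hsf : SigmaFinite MarkedPointProcess.pathMeasure := by
    unfold MarkedPointProcess.pathMeasure
    infer_instance
  have h1 : N.likelihood P T =ᵐ[MarkedPointProcess.pathMeasure]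
      janossy (p.nextDensity T) fun n x => p.survival n x T := by
    unfold MarkedPointProcess.likelihood
    rw [hN.map_path_eq_withDensity hT]
    exact Measure.rnDeriv_withDensity _ hJ
  have h2 : ∀ᵐ r ∂P.map (N.path T),
      janossy (p.nextDensity T) (fun n x => p.survival n x T) r ≠ 0 := by
    rw [hN.map_path_eq_withDensity hT, ae_withDensity_iff hJ]
    exact ae_of_all _ fun _ h => h
  have hm := (N.measurable_path T).aemeasurable (μ := P)
  filter_upwards [ae_of_ae_map hm ((hN.map_path_absolutelyContinuous hT).ae_le h1),
    ae_of_ae_map hm h2] with ω hω1 hω2 using ⟨hω1, hω2⟩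

/-- The formula for the Poisson likelihood holds outside of a null set of lists of times, which the
event times of the process avoid because the law of the path has a density. -/
lemma ae_unitPoissonLikelihood_groundPath (hN : p.IsMarkedHawkes N P T) (hT : 0 ≤ T) :
    ∀ᵐ ω ∂P, unitPoissonLikelihood T (N.groundPath T ω) = ENNReal.ofReal (Real.exp (-T)) := by
  have hg : ∀ ω, N.groundPath T ω
      = (fun r : Realization (ℝ × Fin 2 × ℝ) => realizationOf r.1 fun k => (r.2 k).1)
          (N.path T ω) := fun _ => rfl
  have hm : Measurable fun r : Realization (ℝ × Fin 2 × ℝ) =>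
      realizationOf r.1 fun k => (r.2 k).1 :=
    measurable_realization_iff.2 fun n => (measurable_realization_mk n).comp (by fun_prop)
  have h := ae_of_ae_map hm.aemeasurable ((absolutelyContinuous_map_fst_realizationMeasure volume
    (Measure.count.prod volume : Measure (Fin 2 × ℝ))).ae_le (ae_unitPoissonLikelihood hT))
  have h' := ae_of_ae_map (N.measurable_path T).aemeasurable
    ((hN.map_path_absolutelyContinuous hT).ae_le h)
  filter_upwards [h', hN.ae_finite_events] with ω hω hfin
  obtain ⟨h1, -⟩ := (ncard_le_eq_iff (N.monotone_time ω) hfin _).1 rfl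
  have hlt : ∀ k : Fin {k | N.time k ω ≤ ENNReal.ofReal T}.ncard, N.time k ω < ∞ := fun k =>
    (h1 k k.2).trans_lt ENNReal.ofReal_lt_top
  refine hω (fun j k hjk => ?_) fun k => ⟨?_, ?_⟩
  · exact (ENNReal.toReal_lt_toReal (hlt j).ne (hlt k).ne).2 (N.time_lt_of_lt hjk (hlt j))
  · exact ENNReal.toReal_pos (N.time_pos k ω).ne' (hlt k).ne
  · exact (ENNReal.toReal_mono ENNReal.ofReal_ne_top (h1 k k.2)).trans_eq
      (ENNReal.toReal_ofReal hT)

/-- The log-likelihood in terms of the intensities at the events and of the integrated intensity. -/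
lemma ae_logLikelihood_eq (hN : p.IsMarkedHawkes N P T) (hT : 0 ≤ T) :
    ∀ᵐ ω ∂P, {k | N.time k ω ≤ ENNReal.ofReal T}.Finite ∧ N.logLikelihood P T ω
      = ((T - p.integratedIntensity N T {k | N.time k ω ≤ ENNReal.ofReal T}.ncard ω
          + ∑ k ∈ Finset.range {k | N.time k ω ≤ ENNReal.ofReal T}.ncard,
              Real.log (p.eventIntensity N k ω)
          + ∑ k ∈ Finset.range {k | N.time k ω ≤ ENNReal.ofReal T}.ncard,
              Real.log (p.markDensity N k ω) : ℝ) : EReal) := by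
  filter_upwards [hN.ae_likelihood_path hT, hN.ae_unitPoissonLikelihood_groundPath hT,
    hN.ae_finite_events] with ω ⟨hω1, hω2⟩ hω3 hfin
  refine ⟨hfin, ?_⟩
  obtain ⟨h1, h2⟩ := (ncard_le_eq_iff (N.monotone_time ω) hfin _).1 rfl
  rw [p.janossy_path N hT (hN.lintegral_baseline_ne_top hT) rfl h1 h2] at hω1 hω2
  set n := {k | N.time k ω ≤ ENNReal.ofReal T}.ncard
  have hpos := ENNReal.ofReal_pos.1 (pos_iff_ne_zero.2 hω2)
  have hprod := pos_of_mul_pos_left hpos (Real.exp_pos _).le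
  have hne : ∀ k ∈ Finset.range n, p.eventIntensity N k ω * p.markDensity N k ω ≠ 0 :=
    Finset.prod_ne_zero_iff.1 hprod.ne'
  have hne' : ∀ k ∈ Finset.range n, p.eventIntensity N k ω ≠ 0 := fun k hk =>
    left_ne_zero_of_mul (hne k hk)
  rw [MarkedPointProcess.logLikelihood, hω1, hω3, ← ENNReal.ofReal_div_of_pos (Real.exp_pos _),
    ENNReal.log_ofReal_of_pos (div_pos hpos (Real.exp_pos _)),
    Real.log_div hpos.ne' (Real.exp_pos _).ne', Real.log_mul hprod.ne' (Real.exp_pos _).ne',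
    Real.log_exp, Real.log_exp, Real.log_prod hne,
    Finset.sum_congr rfl fun k hk => Real.log_mul (hne' k hk) (p.markDensity_pos N k ω).ne',
    Finset.sum_add_distrib]
  congr 1
  ring

end HawkesParams.IsMarkedHawkes

end

/-! ### The log-likelihood -/

theorem proposition4p1 {Ω : Type*} [MeasurableSpace Ω] (P : Measure Ω) [IsProbabilityMeasure P]
    (T : ℝ) (hT : 0 < T) (p : HawkesParams) (N : MarkedPointProcess Ω)
    (hN : p.IsMarkedHawkes N P T) :
    -- the two likelihoods exist
    P.map (N.path T) ≪ MarkedPointProcess.pathMeasure ∧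
    unitPoissonLaw T ≪ realizationMeasure volume ∧
    -- and the log-likelihood has the closed form
    ∀ᵐ ω ∂P, N.logLikelihood P T ω =
      ((T
        - ∑ i : Fin 2, ((∫ u in (0 : ℝ)..T, p.μ i u)
          + ∑ j : Fin 2, ∑ l ∈ N.events T j ω with (N.time l ω).toReal < T,
              p.α i j / p.β i j * (p.rate j ^ p.η j / Real.Gamma (1 + p.η j)) *
                N.mark l ω ^ p.η j *
                (1 - Real.exp (-p.β i j * (T - (N.time l ω).toReal))))
        + ∑ i : Fin 2, ∑ k ∈ N.events T i ω,
            Real.log (p.μ i (N.time k ω).toReal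
              + ∑ j : Fin 2,
                  ∑ l ∈ N.events T j ω with (N.time l ω).toReal < (N.time k ω).toReal,
                    p.α i j * (p.rate j ^ p.η j / Real.Gamma (1 + p.η j)) * N.mark l ω ^ p.η j *
                      Real.exp (-p.β i j * ((N.time k ω).toReal - (N.time l ω).toReal)))
        + ∑ i : Fin 2, ∑ k ∈ N.events T i ω,
            Real.log (p.rate i * Real.exp (-p.rate i * N.mark k ω)) : ℝ) : EReal) := by
  refine ⟨hN.map_path_absolutelyContinuous hT.le, ?_, ?_⟩
  · rw [unitPoissonLaw_eq_withDensity hT.le]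
    exact withDensity_absolutelyContinuous _ _
  filter_upwards [hN.ae_logLikelihood_eq hT.le] with ω ⟨hfin, hω⟩
  rw [hω]
  obtain ⟨h1, -⟩ := (ncard_le_eq_iff (N.monotone_time ω) hfin _).1 rfl
  simp only [Finset.sum_filter, N.sum_events T ω]
  set n := {k | N.time k ω ≤ ENNReal.ofReal T}.ncard
  have hlt : ∀ k < n, N.time k ω < ∞ := fun k hk => (h1 k hk).trans_lt ENNReal.ofReal_lt_top
  have hle : ∀ k < n, (N.time k ω).toReal ≤ T := fun k hk =>
    (ENNReal.toReal_mono ENNReal.ofReal_ne_top (h1 k hk)).trans_eq (ENNReal.toReal_ofReal hT.le)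
  congr 3
  · refine congrArg (T - ·) (Finset.sum_congr rfl fun i _ => ?_)
    congr 1
    refine Finset.sum_congr rfl fun l hl => ?_
    simp only [HawkesParams.totalExcitation, MarkedPointProcess.point, HawkesParams.impact_eq]
    -- an event at the time `T` contributes nothing
    rcases (hle l (Finset.mem_range.1 hl)).lt_or_eq with h | h
    · rw [if_pos h]
      ring
    · simp [h]
  · refine Finset.sum_congr rfl fun k hk => ?_
    have hkn := Finset.mem_range.1 hk
    -- the events strictly before the `k`-th one are those with a smaller index
    have hfil : (Finset.range n).filter (fun l => (N.time l ω).toReal < (N.time k ω).toReal)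
        = Finset.range k := by
      ext l
      simp only [Finset.mem_filter, Finset.mem_range]
      constructor
      · rintro ⟨hl, h⟩
        by_contra hkl
        exact absurd (ENNReal.toReal_mono (hlt l hl).ne (N.monotone_time ω (not_lt.1 hkl)))
          (not_le.2 h)
      · intro hl
        have hln := hl.trans hkn
        exact ⟨hln, (ENNReal.toReal_lt_toReal (hlt l hln).ne (hlt k hkn).ne).2
          (N.time_lt_of_lt hl (hlt l hln))⟩
    rw [← Finset.sum_filter, hfil, HawkesParams.eventIntensity]
    congr 2
    refine Finset.sum_congr rfl fun l _ => ?_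
    simp only [HawkesParams.excitation, MarkedPointProcess.point, HawkesParams.impact_eq]
    ring
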